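/- Let $(p_n)_{n\ge 1}$ be real numbers with $0<p_n<1$ such that, as $N\to\infty$ (respectively $n\to\infty$), (1) $\frac{1}{\log N}\sum_{n=1}^N p_n\to\infty$; (2) $\sum_{n=1}^N|p_{n+1}-p_n|=o\bigl(\sum_{n=1}^N p_n\bigr)$; (3) $p_n=O\bigl(n^{-(1-\varepsilon)}\bigr)$ for every $\varepsilon\in(0,1)$. Let $(\xi_n)_{n\ge1}$ be independent random variables on a probability space $(\Omega,\mathcal F,\mathbb P)$ with $\mathbb P(\xi_n=1)=p_n$ and $\mathbb P(\xi_n=0)=1-p_n$, and let $A(\omega)=\{n\ge 1:\xi_n(\omega)=1\}$. Then, for almost every $\omega$, the set $A(\omega)$ is infinite, and its strictly increasing enumeration $(n_k)_{k\ge0}$ has the following properties. (a) $(n_k)$ is nullpotent: there is a Hausdorff group topology on $\mathbb Z$ for which $n_k\to0$. (b) $Q=\{n_k: k\ge 0\}$ is a Kazhdan set: there is $\varepsilon>0$ such that every unitary operator $U$ on a complex separable Hilbert space $H$ for which some $x\in H$ with $\|x\|=1$ satisfies $\sup_{n\in Q}\|U^nx-x\|<\varepsilon$ has a non-zero fixed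 vector. (c) $(n_k)$ is not a rigidity sequence: there is no weakly mixing measure-preserving system $(X,\mathcal B,m;T)$ on a non-trivial probability space (one having a measurable set of measure strictly between $0$ and $1$) such that $m(T^{-n_k}B\,\triangle\, B)\to0$ for every $B\in\mathcal B$. Here weakly mixing means that for every $f\in L^2(m)$ with $\int f\,dm=0$ the spectral measure of $f$, that is, the finite Borel measure $\sigma$ on the unit circle $\mathbb T$ with $\int_{\mathbb T} z^n\,d\sigma(z)=\langle f\circ T^n,f\rangle_{L^2(m)}$ for all $n\ge0$, has no atoms. (d) For every $a\in\mathbb Z$, the translate $R=\{n_k+a: k\ge0\}$ is a set of recurrence: for every measure-preserving system $(X,\mathcal B,m;T)$ on a probability space and every $B\in\mathcal B$ with $m(B)>0$, there is $r\in R\setminus\{0\}$ with $m(B\cap T^{-r}B)>0$ (where for $r<0$ and $T$ not invertible, $m(B\cap T^{-r}B)$ is understood as $m(B\cap T^{-|r|}B)$; for invertible $T$ the two are equal). -/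

import Mathlib

open MeasureTheory ProbabilityTheory Filter Topology

universe u v w

/-- A set `Q` of integers is a *Kazhdan set* if there is `ε > 0` such that every unitary operator
`U` on a complex separable Hilbert space that has a unit vector `x` with
`sup_{n ∈ Q} ‖U ^ n x - x‖ < ε` has a non-zero fixed vector. (The supremum is over a set of reals
bounded by `2`, and it is `0` when `Q` is empty.) -/
def IsKazhdanSet (Q : Set ℤ) : Prop :=
  ∃ ε : ℝ, 0 < ε ∧
    ∀ (H : Type u) [NormedAddCommGroup H] [InnerProductSpace ℂ H] [CompleteSpace H]
      [TopologicalSpace.SeparableSpace H] (U : H ≃ₗᵢ[ℂ] H),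
      (∃ x : H, ‖x‖ = 1 ∧ (⨆ n : Q, ‖(U ^ (n : ℤ)) x - x‖) < ε) →
        ∃ y : H, y ≠ 0 ∧ U y = y

/-- A sequence of integers is *nullpotent* if it tends to `0` for some Hausdorff group topology
on `ℤ`. -/
def IsNullpotent (n : ℕ → ℤ) : Prop :=
  ∃ τ : TopologicalSpace ℤ, @T2Space ℤ τ ∧ @IsTopologicalAddGroup ℤ τ _ ∧
    Tendsto n atTop (@nhds ℤ τ 0)

/-- The Borel σ-algebra of the unit circle. -/
noncomputable instance instMeasurableSpaceCircleBorel : MeasurableSpace Circle := borel Circle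

instance instBorelSpaceCircle : BorelSpace Circle := ⟨rfl⟩

/-- `σ` is the spectral measure of `f` for the Koopman operator `g ↦ g ∘ T` on `L²(m)`: its
Fourier coefficients `∫ z ^ n dσ(z)`, `n ≥ 0`, are the numbers `⟨f ∘ T ^ n, f⟩`. (These
coefficients determine a finite measure on the circle.) -/
def IsSpectralMeasure {X : Type u} [MeasurableSpace X] (m : Measure X) (T : X → X) (f : X → ℂ)
    (σ : Measure Circle) : Prop :=
  IsFiniteMeasure σ ∧
    ∀ n : ℕ, ∫ z : Circle, (z : ℂ) ^ n ∂σ = ∫ x, f (T^[n] x) * (starRingEnd ℂ) (f x) ∂m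

/-- `T` is a *weakly mixing* measure-preserving transformation of the non-trivial probability
space `(X, m)`: the spectral measures of the Koopman operator on
`L²₀(m) = {f ∈ L²(m) | ∫ f dm = 0}` are continuous (atomless). -/
structure IsWeaklyMixing {X : Type u} [MeasurableSpace X] (m : Measure X) (T : X → X) : Prop where
  isProbabilityMeasure : IsProbabilityMeasure m
  /-- The space is not trivial, that is, `L²₀(m) ≠ 0`. -/
  nontrivial : ∃ A : Set X, MeasurableSet A ∧ 0 < m A ∧ m A < 1
  measurePreserving : MeasurePreserving T m m
  continuous_spectrum : ∀ f : X → ℂ, MemLp f 2 m → ∫ x, f x ∂m = 0 →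
    ∃ σ : Measure Circle, IsSpectralMeasure m T f σ ∧ ∀ z : Circle, σ {z} = 0

/-- A sequence `(n_k)` is a *rigidity sequence* if there is a weakly mixing system `(X, m; T)` such
that `m (T^{-n_k} A ∆ A) → 0` for every measurable set `A`. -/
def IsRigiditySequence (n : ℕ → ℕ) : Prop :=
  ∃ (X : Type u) (_ : MeasurableSpace X) (m : Measure X) (T : X → X), IsWeaklyMixing m T ∧
    ∀ A : Set X, MeasurableSet A →
      Tendsto (fun k => m (symmDiff (T^[n k] ⁻¹' A) A)) atTop (𝓝 0)

/-- A set `R` of integers is a *set of recurrence* if for every measure-preserving system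
`(X, m; T)` on a probability space and every measurable `A` with `m A > 0` there is
`r ∈ R \ {0}` with `m (A ∩ T^{-r} A) > 0`.

Transformations need not be invertible. For `r < 0` the number `m (A ∩ T^{-r} A)` is read as
`m (A ∩ T^{-|r|} A)`; both are equal when `T` is invertible, see
`measure_inter_zpow_preimage`. -/
def IsSetOfRecurrence (R : Set ℤ) : Prop :=
  ∀ (X : Type u) [MeasurableSpace X] (m : Measure X) [IsProbabilityMeasure m] (T : X → X),
    MeasurePreserving T m m → ∀ A : Set X, MeasurableSet A → 0 < m A →
      ∃ r ∈ R, r ≠ 0 ∧ 0 < m (A ∩ T^[r.natAbs] ⁻¹' A)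

/-- For an invertible system, `m (A ∩ T^{-r} A) = m (A ∩ T^{-|r|} A)` for all integers `r`. -/
theorem measure_inter_zpow_preimage {X : Type u} [MeasurableSpace X] (m : Measure X)
    (T : X ≃ᵐ X) (hT : MeasurePreserving T m m) (A : Set X) (hA : MeasurableSet A) (r : ℤ) :
    m (A ∩ ((T.toEquiv : Equiv.Perm X) ^ r) ⁻¹' A) = m (A ∩ T^[r.natAbs] ⁻¹' A) := by
  have key : ∀ n : ℕ, (((T.toEquiv : Equiv.Perm X) ^ n : Equiv.Perm X) : X → X) = T^[n] := by
    intro n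
    exact Equiv.Perm.coe_pow _ n
  rcases Int.natAbs_eq r with h | h
  · rw [h, zpow_natCast, key, Int.natAbs_natCast]
  · generalize r.natAbs = n at h
    subst h
    rw [zpow_neg, zpow_natCast]
    have himg : (((T.toEquiv : Equiv.Perm X) ^ n)⁻¹ : Equiv.Perm X) ⁻¹' A
        = ((T.symm : X → X)^[n]) ⁻¹' A := by
      rw [← inv_pow, Equiv.Perm.coe_pow]
      rfl
    have hmeas : MeasurableSet (A ∩ (T.symm : X → X)^[n] ⁻¹' A) :=
      hA.inter ((T.symm.measurable.iterate n) hA)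
    rw [himg, ← (hT.iterate n).measure_preimage hmeas.nullMeasurableSet]
    congr 1
    have hinv : Function.LeftInverse (T.symm : X → X)^[n] T^[n] :=
      Function.LeftInverse.iterate T.symm_apply_apply n
    ext x
    simp only [Set.mem_preimage, Set.mem_inter_iff, hinv x]
    exact and_comm

/-- The random set `A(ω) = {n ≥ 1 | ξ_n(ω) = 1}`. -/
def randomSet {Ω : Type u} (ξ : ℕ → Ω → ℝ) (ω : Ω) : Set ℕ :=
  {n | 1 ≤ n ∧ ξ n ω = 1}

/-- The increasing enumeration `(n_k(ω))_{k ≥ 0}` of `A(ω)`, when that set is infinite. -/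
noncomputable def randomSeq {Ω : Type u} (ξ : ℕ → Ω → ℝ) (ω : Ω) (k : ℕ) : ℕ :=
  Nat.nth (fun n => n ∈ randomSet ξ ω) k

/-!
The Kazhdan property, the failure of rigidity and the recurrence of all translates are consequences
of one deterministic property of the random sequence `(n_k)`, called `IsUniformlyErgodic` below:
`(z - 1) ∑_{k < K} z ^ (n_k) = o(K)` uniformly for `|z| = 1`. By von Neumann's inequality, which
`LinearIsometry.norm_aeval_apply_le` proves for arbitrary linear isometries `U`, it implies that the
averages of `U ^ (n_k) x` converge to a fixed vector
(`IsUniformlyErgodic.exists_tendsto_average`). Applied to a unitary operator this gives the Kazhdan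
property, and applied to a Koopman operator on `L²` the recurrence of every translate. For a measure
`σ` on the circle without an atom at `1`, the averages of `∫ z ^ (n_k) dσ` tend to `0`, whereas for
a spectral measure along a rigidity sequence they tend to the total mass.

The random sequence has this property almost surely. A Bernstein inequality, a union bound over the
`N ^ 3`-th roots of unity and the Borel–Cantelli lemma show that
`∑_{n ≤ N} (ξ_n - p_n) z ^ n` is `o(∑_{n ≤ N} p_n)` uniformly in `z`
(`ae_eventually_norm_sum_pow_le`); this uses that `∑_{n ≤ N} p_n` grows faster than `log N`. The
remaining sum `(z - 1) ∑_{n ≤ N} p_n z ^ n` is `o(∑_{n ≤ N} p_n)` by summation by parts and the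
hypothesis on the variation of `p` (`norm_sub_one_mul_sum_pow_le`). Both estimates are combined in
`infinite_and_isUniformlyErgodic_nth`.

For nullpotency, a criterion of Protasov and Zelenyuk
(`isNullpotent_of_forall_notMem_tailSumset`) reduces the claim to: for every `g ≠ 0` and `m`,
the integer `g` is not a signed sum of `m` terms `n_k` with large indices. In such a sum
the largest term is determined by the others and the coefficients. Since
`p_n = O(n ^ (-1 + ε))`, the probability that a relation with second largest term `L` exists is at
most a power of `L` with exponent close to `-2` (`measureReal_hasRelationAt_le`), and
the Borel–Cantelli lemma applies.
-/

/-! ### Von Neumann's inequality and uniformly ergodic sequences -/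

/-- Parseval's identity on `ZMod M` for functions with values in an inner product space. -/
theorem sum_norm_sq_sum_stdAddChar_smul {M : ℕ} [NeZero M] {H : Type*} [NormedAddCommGroup H]
    [InnerProductSpace ℂ H] (v : ZMod M → H) :
    ∑ k, ‖∑ j, ZMod.stdAddChar (j * k) • v j‖ ^ 2 = M * ∑ j, ‖v j‖ ^ 2 := by
  have key : ∀ j l : ZMod M, ∑ k : ZMod M,
      (starRingEnd ℂ) (ZMod.stdAddChar (j * k)) * ZMod.stdAddChar (l * k) =
        if j = l then (M : ℂ) else 0 := by
    intro j l
    have h := AddChar.sum_mulShift (l - j) (ZMod.isPrimitive_stdAddChar M)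
    rw [ZMod.card] at h
    simp only [sub_eq_zero, eq_comm (a := l)] at h
    rw [← Nat.cast_zero (R := ℂ), ← Nat.cast_ite, ← h]
    refine Finset.sum_congr rfl fun k _ => ?_
    rw [← AddChar.map_neg_eq_conj, ← AddChar.map_add_eq_mul]
    congr 1
    ring
  have : ((∑ k, ‖∑ j, ZMod.stdAddChar (j * k) • v j‖ ^ 2 : ℝ) : ℂ) =
      ((M * ∑ j, ‖v j‖ ^ 2 : ℝ) : ℂ) := by
    push_cast
    simp only [← Complex.coe_algebraMap, ← inner_self_eq_norm_sq_to_K (𝕜 := ℂ), sum_inner,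
      inner_sum, inner_smul_left, inner_smul_right]
    calc _ = ∑ l, ∑ j, (∑ k : ZMod M,
      (starRingEnd ℂ) (ZMod.stdAddChar (j * k)) * ZMod.stdAddChar (l * k)) *
        inner ℂ (v j) (v l) := by
          rw [Finset.sum_comm]
          refine Finset.sum_congr rfl fun l _ => ?_
          simp only [Finset.mul_sum]
          rw [Finset.sum_comm]
          refine Finset.sum_congr rfl fun j _ => ?_
          rw [Finset.sum_mul]
          refine Finset.sum_congr rfl fun k _ => ?_
          ring
      _ = _ := by simp [key, Finset.mul_sum]
  exact_mod_cast this

/-- Von Neumann's inequality for a linear isometry `U` that need not be onto: `‖q(U) x‖` is at most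
`sup_{|z| = 1} |q(z)| ‖x‖`. On `ZMod M`, convolve the coefficients of `q` with the reversed orbit
`i ↦ U ^ (M - 1 - i) x`. All but `deg q` values of the convolution are images of `q(U) x` under
powers of `U`, so Parseval's identity gives the inequality up to a factor `M / (M - deg q)`, and
`M` is arbitrary. -/
theorem LinearIsometry.norm_aeval_apply_le {H : Type*} [NormedAddCommGroup H]
    [InnerProductSpace ℂ H] (U : H →ₗᵢ[ℂ] H) (q : Polynomial ℂ) {C : ℝ}
    (hC : ∀ z : ℂ, ‖z‖ = 1 → ‖q.eval z‖ ≤ C) (x : H) :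
    ‖Polynomial.aeval U.toLinearMap q x‖ ≤ C * ‖x‖ := by
  have hC0 : 0 ≤ C := (norm_nonneg _).trans (hC 1 (by simp))
  set d := q.natDegree with hd
  set y := Polynomial.aeval U.toLinearMap q x with hy
  have hnorm : ∀ (n : ℕ) (z : H), ‖(U.toLinearMap ^ n) z‖ = ‖z‖ := by
    intro n
    induction n with
    | zero => simp
    | succ n ih => intro z; rw [pow_succ, Module.End.mul_apply, ih]; exact U.norm_map z
  -- `w` is the convolution of the coefficients of `q` with the reversed orbit `v`
  have main : ∀ M : ℕ, d < M → ((M : ℝ) - d) * ‖y‖ ^ 2 ≤ M * (C * ‖x‖) ^ 2 := by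
    intro M hM
    have : NeZero M := ⟨by omega⟩
    have hM0 : (0 : ℝ) < M := by exact_mod_cast (show 0 < M by omega)
    set v : ZMod M → H := fun i => (U.toLinearMap ^ (M - 1 - i.val)) x with hv
    set w : ZMod M → H := fun m => ∑ j ∈ Finset.range (d + 1), q.coeff j • v (m - j) with hw
    have hw_fourier : ∀ k : ZMod M, ∑ m, ZMod.stdAddChar (m * k) • w m =
        q.eval (ZMod.stdAddChar k) • ∑ m, ZMod.stdAddChar (m * k) • v m := by
      intro k
      rw [Polynomial.eval_eq_sum_range, Finset.sum_smul, ← hd]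
      simp only [hw, Finset.smul_sum]
      rw [Finset.sum_comm]
      refine Finset.sum_congr rfl fun j _ => ?_
      rw [← Equiv.sum_comp (Equiv.addRight (j : ZMod M))]
      refine Finset.sum_congr rfl fun m _ => ?_
      simp only [Equiv.coe_addRight, add_sub_cancel_right, add_mul, AddChar.map_add_eq_mul,
        smul_smul]
      congr 1
      rw [← nsmul_eq_mul, AddChar.map_nsmul_eq_pow]
      ring
    have hle : ∑ m, ‖w m‖ ^ 2 ≤ C ^ 2 * ∑ m, ‖v m‖ ^ 2 := by
      have h1 := sum_norm_sq_sum_stdAddChar_smul w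
      have h2 := sum_norm_sq_sum_stdAddChar_smul v
      have h3 : ∑ k, ‖∑ j, ZMod.stdAddChar (j * k) • w j‖ ^ 2 ≤
          ∑ k, C ^ 2 * ‖∑ j, ZMod.stdAddChar (j * k) • v j‖ ^ 2 := by
        refine Finset.sum_le_sum fun k _ => ?_
        rw [hw_fourier, norm_smul, mul_pow]
        gcongr
        exact hC _ (Circle.norm_coe (ZMod.toCircle k))
      rw [← Finset.mul_sum, h1, h2] at h3
      nlinarith
    have hvx : ∑ m, ‖v m‖ ^ 2 = M * ‖x‖ ^ 2 := by
      simp [hv, hnorm, ZMod.card]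
    -- from index `d` on, the convolution does not wrap around
    have hwy : ∀ n ∈ Finset.Ico d M, ‖w (n : ZMod M)‖ = ‖y‖ := by
      intro n hn
      rw [Finset.mem_Ico] at hn
      have : w (n : ZMod M) = (U.toLinearMap ^ (M - 1 - n)) y := by
        simp only [hw, hy, Polynomial.aeval_eq_sum_range, LinearMap.sum_apply, map_sum,
          LinearMap.smul_apply, map_smul, ← hd, hv]
        refine Finset.sum_congr rfl fun j hj => ?_
        rw [Finset.mem_range] at hj
        rw [← Module.End.mul_apply, ← pow_add, ← Nat.cast_sub (by omega),
          ZMod.val_natCast_of_lt (by omega)]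
        congr 3
        omega
      rw [this, hnorm]
    have hsub : ∑ n ∈ Finset.Ico d M, ‖w (n : ZMod M)‖ ^ 2 ≤ ∑ m, ‖w m‖ ^ 2 := by
      rw [← Finset.sum_image (g := fun n : ℕ => (n : ZMod M)) (f := fun m => ‖w m‖ ^ 2)]
      · exact Finset.sum_le_univ_sum_of_nonneg fun _ => by positivity
      · intro a ha b hb hab
        simp only [Finset.coe_Ico, Set.mem_Ico] at ha hb
        have := congrArg ZMod.val hab
        rwa [ZMod.val_natCast_of_lt ha.2, ZMod.val_natCast_of_lt hb.2] at this
    rw [Finset.sum_congr rfl fun n hn => by rw [hwy n hn], Finset.sum_const, Nat.card_Ico,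
      nsmul_eq_mul, Nat.cast_sub hM.le] at hsub
    calc _ ≤ _ := hsub
      _ ≤ _ := hle
      _ = _ := by rw [hvx]; ring
  by_contra! hlt
  have hsq : (C * ‖x‖) ^ 2 < ‖y‖ ^ 2 := by gcongr
  obtain ⟨M, hM⟩ := exists_nat_gt (d * ‖y‖ ^ 2 / (‖y‖ ^ 2 - (C * ‖x‖) ^ 2))
  rw [div_lt_iff₀ (by linarith)] at hM
  have h := main (M + d + 1) (by omega)
  push_cast at h
  nlinarith [mul_nonneg (Nat.cast_nonneg d : (0 : ℝ) ≤ d) (sq_nonneg (C * ‖x‖)),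
    mul_nonneg (Nat.cast_nonneg d : (0 : ℝ) ≤ d) (sub_pos.2 hsq).le]

/-- The exponential sums `∑_{k < K} z ^ (n k)`, multiplied by `z - 1`, are `o(K)` uniformly in `z`
on the unit circle. The factor `z - 1` makes uniformity possible up to the point `z = 1`, where the
sum is `K`. -/
def IsUniformlyErgodic (n : ℕ → ℕ) : Prop :=
  ∀ ε : ℝ, 0 < ε → ∀ᶠ K : ℕ in atTop, ∀ z : ℂ, ‖z‖ = 1 →
    ‖(z - 1) * ∑ k ∈ Finset.range K, z ^ n k‖ ≤ ε * K

/-- A mean ergodic theorem along the sequence `n`. On the range of `U - 1` the averages tend to `0`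
by von Neumann's inequality applied to `(z - 1) ∑ z ^ (n k)`, and the orthogonal complement of that
range consists of fixed vectors. -/
theorem IsUniformlyErgodic.exists_tendsto_average {n : ℕ → ℕ} (hn : IsUniformlyErgodic n)
    {H : Type*} [NormedAddCommGroup H] [InnerProductSpace ℂ H] [CompleteSpace H]
    (U : H →ₗᵢ[ℂ] H) (x : H) :
    ∃ y : H, U y = y ∧ Tendsto (fun K : ℕ => (K : ℂ)⁻¹ • ∑ k ∈ Finset.range K, U^[n k] x)
      atTop (𝓝 y) := by
  have hpow : ∀ (j : ℕ) (z : H), U^[j] z = (U.toLinearMap ^ j) z := by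
    intro j z
    rw [Module.End.pow_apply]
    rfl
  have hnorm : ∀ (j : ℕ) (z : H), ‖U^[j] z‖ = ‖z‖ := by
    intro j z
    induction j with
    | zero => rfl
    | succ j ih => rw [Function.iterate_succ_apply', U.norm_map, ih]
  have hU1 : ∀ (K : ℕ) (z : H), ‖(K : ℂ)⁻¹ • ∑ k ∈ Finset.range K, U^[n k] z‖ ≤ ‖z‖ := by
    intro K z
    rcases Nat.eq_zero_or_pos K with rfl | hK
    · simp
    have : (0 : ℝ) < K := by exact_mod_cast hK
    rw [norm_smul, norm_inv, Complex.norm_natCast, inv_mul_le_iff₀ this]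
    refine (norm_sum_le _ _).trans ?_
    simp [hnorm]
  set R : Submodule ℂ H := (U.toLinearMap - 1).range.topologicalClosure with hR
  have : CompleteSpace R := (Submodule.isClosed_topologicalClosure _).completeSpace_coe
  obtain ⟨r, hr, y, hy, rfl⟩ := R.exists_add_mem_mem_orthogonal x
  have hUy : U y = y := by
    refine eq_of_norm_le_re_inner_eq_norm_sq (𝕜 := ℂ) (U.norm_map y).le ?_
    have h1 : inner ℂ (U y - y) y = 0 :=
      (Submodule.mem_orthogonal _ _).1 hy _ (Submodule.le_topologicalClosure _ ⟨y, rfl⟩)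
    rw [inner_sub_left, sub_eq_zero] at h1
    rw [h1, inner_self_eq_norm_sq_to_K]
    norm_cast
  have hUy' : ∀ j, U^[j] y = y := fun j => Function.iterate_fixed hUy j
  refine ⟨y, hUy, ?_⟩
  have hr0 : Tendsto (fun K : ℕ => (K : ℂ)⁻¹ • ∑ k ∈ Finset.range K, U^[n k] r)
      atTop (𝓝 0) := by
    rw [Metric.tendsto_atTop']
    intro ε hε
    have hr' : r ∈ closure ((U.toLinearMap - 1).range : Set H) := hr
    obtain ⟨_, ⟨s, rfl⟩, hs⟩ := Metric.mem_closure_iff.1 hr' (ε / 2) (by positivity)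
    set t := (U.toLinearMap - 1) s with ht
    obtain ⟨K₀, hK₀⟩ := eventually_atTop.1 (hn (ε / (2 * (‖s‖ + 1))) (by positivity))
    refine ⟨K₀ + 1, fun K hK => ?_⟩
    have hKpos : (0 : ℝ) < K := by exact_mod_cast (show 0 < K by omega)
    have h1 := U.norm_aeval_apply_le ((Polynomial.X - 1 : Polynomial ℂ) *
      ∑ k ∈ Finset.range K, Polynomial.X ^ n k) (C := ε / (2 * (‖s‖ + 1)) * K) (by
        intro z hz
        simpa [Polynomial.eval_finsetSum] using hK₀ K (by omega) z hz) s
    have h2 : Polynomial.aeval U.toLinearMap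
        ((Polynomial.X - 1 : Polynomial ℂ) * ∑ k ∈ Finset.range K, Polynomial.X ^ n k) s =
        ∑ k ∈ Finset.range K, U^[n k] t := by
      rw [mul_comm]
      simp [ht, hpow]
    rw [h2] at h1
    have h3 : ‖(K : ℂ)⁻¹ • ∑ k ∈ Finset.range K, U^[n k] t‖ < ε / 2 := by
      rw [norm_smul, norm_inv, Complex.norm_natCast, inv_mul_lt_iff₀ hKpos]
      refine h1.trans_lt ?_
      have : ε / (2 * (‖s‖ + 1)) * K * ‖s‖ = (K * (ε / 2)) * (‖s‖ / (‖s‖ + 1)) := by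
        field_simp
      rw [this]
      refine mul_lt_of_lt_one_right (by positivity) ?_
      rw [div_lt_one (by positivity)]
      linarith
    have h4 : (K : ℂ)⁻¹ • ∑ k ∈ Finset.range K, U^[n k] r =
        (K : ℂ)⁻¹ • ∑ k ∈ Finset.range K, U^[n k] (r - t) +
        (K : ℂ)⁻¹ • ∑ k ∈ Finset.range K, U^[n k] t := by
      rw [← smul_add, ← Finset.sum_add_distrib]
      simp [hpow]
    rw [dist_zero_right, h4]
    refine (norm_add_le _ _).trans_lt ?_
    have h5 := hU1 K (r - t)
    rw [dist_eq_norm] at hs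
    linarith
  have hsplit : ∀ K : ℕ, 0 < K → (K : ℂ)⁻¹ • ∑ k ∈ Finset.range K, U^[n k] (r + y) =
      (K : ℂ)⁻¹ • ∑ k ∈ Finset.range K, U^[n k] r + y := by
    intro K hK
    have hK' : (K : ℂ) ≠ 0 := by exact_mod_cast hK.ne'
    simp only [hpow, map_add, Finset.sum_add_distrib, smul_add]
    simp only [← hpow, hUy', Finset.sum_const, Finset.card_range]
    rw [← Nat.cast_smul_eq_nsmul ℂ, smul_smul, inv_mul_cancel₀ hK', one_smul]
  have := hr0.add_const y
  rw [zero_add] at this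
  refine this.congr' ?_
  filter_upwards [eventually_gt_atTop 0] with K hK
  exact (hsplit K hK).symm

/-- If `U ^ (n k) x` stays within distance `s < 1` of the unit vector `x`, so does the limit of the
averages, which is therefore a non-zero fixed vector. -/
theorem IsUniformlyErgodic.isKazhdanSet {n : ℕ → ℕ} (hn : IsUniformlyErgodic n) :
    IsKazhdanSet.{v} (Set.range fun k => (n k : ℤ)) := by
  refine ⟨1, one_pos, ?_⟩
  rintro H _ _ _ _ U ⟨x, hx, hsup⟩
  obtain ⟨y, hUy, hy⟩ := hn.exists_tendsto_average U.toLinearIsometry x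
  refine ⟨y, ?_, hUy⟩
  rintro rfl
  set s := ⨆ m : (Set.range fun k => (n k : ℤ)), ‖(U ^ (m : ℤ)) x - x‖ with hs
  have hiter : ∀ j : ℕ, U.toLinearIsometry^[j] x = (U ^ (j : ℤ)) x := by
    intro j
    rw [zpow_natCast]
    induction j with
    | zero => rfl
    | succ j ih => rw [Function.iterate_succ_apply', ih, pow_succ']; rfl
  have hbound : ∀ k, ‖U.toLinearIsometry^[n k] x - x‖ ≤ s := by
    intro k
    rw [hiter]
    refine le_ciSup (f := fun m : (Set.range fun k => (n k : ℤ)) => ‖(U ^ (m : ℤ)) x - x‖) ?_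
      ⟨(n k : ℤ), k, rfl⟩
    refine ⟨2, ?_⟩
    rintro _ ⟨m, rfl⟩
    refine (norm_sub_le _ _).trans ?_
    rw [LinearIsometryEquiv.norm_map, hx]
    norm_num
  have hav : ∀ᶠ K : ℕ in atTop,
      ‖(K : ℂ)⁻¹ • ∑ k ∈ Finset.range K, U.toLinearIsometry^[n k] x - x‖ ≤ s := by
    filter_upwards [eventually_gt_atTop 0] with K hK
    have hK' : (0 : ℝ) < K := by exact_mod_cast hK
    have hK'' : (K : ℂ) ≠ 0 := by exact_mod_cast hK.ne'
    have : (K : ℂ)⁻¹ • ∑ k ∈ Finset.range K, U.toLinearIsometry^[n k] x - x =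
        (K : ℂ)⁻¹ • ∑ k ∈ Finset.range K, (U.toLinearIsometry^[n k] x - x) := by
      rw [Finset.sum_sub_distrib, smul_sub, Finset.sum_const, Finset.card_range,
        ← Nat.cast_smul_eq_nsmul ℂ, smul_smul, inv_mul_cancel₀ hK'', one_smul]
    rw [this, norm_smul, norm_inv, Complex.norm_natCast, inv_mul_le_iff₀ hK']
    refine (norm_sum_le _ _).trans ((Finset.sum_le_sum fun k _ => hbound k).trans ?_)
    simp
  have := le_of_tendsto (hy.sub_const x).norm hav
  rw [zero_sub, norm_neg, hx] at this
  linarith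

/-! ### Recurrence and rigidity -/

/-- For the Koopman isometry `U` and `f = 1_A`, the averages of `U ^ (n k) f` tend to an invariant
`y` with `⟨1, y⟩ = m A`. If no return time of `A` lies in the translate, the averages of `⟨f, U ^ (n
k + a) f⟩` tend to `0`; they also tend to `⟨f, y⟩ = ‖y‖²`, which forces `y = 0`. -/
theorem IsUniformlyErgodic.isSetOfRecurrence {n : ℕ → ℕ} (hn : IsUniformlyErgodic n)
    (hn' : Tendsto n atTop atTop) (a : ℤ) :
    IsSetOfRecurrence.{w} ((fun x : ℤ => x + a) '' Set.range fun k => (n k : ℤ)) := by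
  intro X _ m _ T hT A hA hA0
  by_contra! hcon
  set f : Lp ℂ 2 m := indicatorConstLp 2 hA (measure_ne_top m A) (1 : ℂ) with hf
  set e : Lp ℂ 2 m := indicatorConstLp 2 MeasurableSet.univ (measure_ne_top m _) (1 : ℂ) with he
  set U : Lp ℂ 2 m →ₗᵢ[ℂ] Lp ℂ 2 m := Lp.compMeasurePreservingₗᵢ ℂ T hT with hU
  have hpow : ∀ (j : ℕ) (z : Lp ℂ 2 m), U^[j] z = (U.toLinearMap ^ j) z := by
    intro j z
    rw [Module.End.pow_apply]
    rfl
  have hinner : ∀ (j : ℕ) (z z' : Lp ℂ 2 m), inner ℂ (U^[j] z) (U^[j] z') = inner ℂ z z' := by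
    intro j z z'
    induction j with
    | zero => rfl
    | succ j ih => rw [Function.iterate_succ_apply', Function.iterate_succ_apply',
        U.inner_map_map, ih]
  have hUind : ∀ (j : ℕ) (B : Set X) (hB : MeasurableSet B),
      U^[j] (indicatorConstLp 2 hB (measure_ne_top m B) (1 : ℂ)) =
        indicatorConstLp 2 ((hT.iterate j).measurable hB) (measure_ne_top m _) (1 : ℂ) := by
    intro j B hB
    have := Lp.compMeasurePreserving_iterate (E := ℂ) (p := 2) hT j
    rw [← Lp.indicatorConstLp_compMeasurePreserving hB (measure_ne_top m B) 1 (hT.iterate j)]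
    rw [← this]
    rfl
  have hUf : ∀ j, inner ℂ f (U^[j] f) = (m.real (A ∩ T^[j] ⁻¹' A) : ℂ) := by
    intro j
    rw [hf, hUind, L2.inner_indicatorConstLp_indicatorConstLp]
    simp
  have hUe : ∀ j, U^[j] e = e := by
    intro j
    rw [he, hUind]
    congr 1
  obtain ⟨y, hUy, hy⟩ := hn.exists_tendsto_average U f
  have hUy' : ∀ j, U^[j] y = y := fun j => Function.iterate_fixed hUy j
  -- inner products with the averages are averages of inner products
  have hinner_avg : ∀ (z : Lp ℂ 2 m) (K : ℕ),
      inner ℂ z ((K : ℂ)⁻¹ • ∑ k ∈ Finset.range K, U^[n k] f) =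
        (K : ℂ)⁻¹ * ∑ k ∈ Finset.range K, inner ℂ z (U^[n k] f) := by
    intro z K
    rw [inner_smul_right, inner_sum]
  have hconst : ∀ z : Lp ℂ 2 m, (∀ j, inner ℂ z (U^[j] f) = inner ℂ z f) →
      inner ℂ z y = inner ℂ z f := by
    intro z hz
    refine tendsto_nhds_unique (tendsto_const_nhds.inner hy) (tendsto_const_nhds.congr' ?_)
    filter_upwards [eventually_gt_atTop 0] with K hK
    have hK'' : (K : ℂ) ≠ 0 := by exact_mod_cast hK.ne'
    rw [hinner_avg, Finset.sum_congr rfl fun k _ => hz (n k), Finset.sum_const,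
      Finset.card_range, nsmul_eq_mul, inv_mul_cancel_left₀ hK'']
  have hyf : inner ℂ y y = inner ℂ y f := by
    refine hconst y fun j => ?_
    conv_lhs => rw [← hUy' j]
    exact hinner j y f
  have hey : inner ℂ e y = inner ℂ e f := by
    refine hconst e fun j => ?_
    conv_lhs => rw [← hUe j]
    exact hinner j e f
  -- with `a = c - b`, move `U ^ b` to the other side, since `U` need not be invertible
  set b := (-a).toNat with hb
  set c := a.toNat with hc
  have hzero : ∀ᶠ k in atTop, inner ℂ (U^[b] f) (U^[c] (U^[n k] f)) = 0 := by
    filter_upwards [hn'.eventually_gt_atTop b] with k hk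
    have h1 : c + n k = b + (n k + c - b) := by omega
    rw [← Function.iterate_add_apply, h1, Function.iterate_add_apply, hinner, hUf]
    have h2 := hcon ((n k : ℤ) + a) ⟨n k, ⟨k, rfl⟩, rfl⟩ (by omega)
    have h3 : ((n k : ℤ) + a).natAbs = n k + c - b := by omega
    rw [h3] at h2
    simp [measureReal_def, le_antisymm h2 bot_le]
  have hyy : inner ℂ y y = (0 : ℂ) := by
    have h1 : inner ℂ (U^[b] f) (U^[c] y) = inner ℂ y y := by
      conv_lhs => rw [hUy', ← hUy' b]
      rw [hinner, ← inner_conj_symm, ← hyf, inner_conj_symm]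
    have h2 : Tendsto (fun K : ℕ => inner ℂ (U^[b] f)
        (U^[c] ((K : ℂ)⁻¹ • ∑ k ∈ Finset.range K, U^[n k] f))) atTop (𝓝 (inner ℂ y y)) := by
      rw [← h1]
      exact tendsto_const_nhds.inner (((U.continuous.iterate c).tendsto y).comp hy)
    refine tendsto_nhds_unique h2 ?_
    have h3 := (tendsto_nhds_of_eventually_eq hzero).cesaro_smul
    refine h3.congr fun K => ?_
    simp only [hpow, map_smul, map_sum, inner_smul_right, inner_sum]
    rw [Complex.real_smul]
    push_cast
    rfl
  have hy0 : y = 0 := inner_self_eq_zero.1 hyy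
  rw [hy0, inner_zero_right] at hey
  rw [he, hf, L2.inner_indicatorConstLp_indicatorConstLp] at hey
  have hpos : 0 < (m A).toReal := ENNReal.toReal_pos hA0.ne' (measure_ne_top m A)
  simp [measureReal_def] at hey
  exact hpos.ne (by exact_mod_cast hey)

theorem IsUniformlyErgodic.tendsto_average_pow {n : ℕ → ℕ} (hn : IsUniformlyErgodic n)
    {z : ℂ} (hz : ‖z‖ = 1) (hz1 : z ≠ 1) :
    Tendsto (fun K : ℕ => (K : ℂ)⁻¹ * ∑ k ∈ Finset.range K, z ^ n k) atTop (𝓝 0) := by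
  have hz' : 0 < ‖z - 1‖ := norm_pos_iff.2 (sub_ne_zero.2 hz1)
  rw [Metric.tendsto_atTop']
  intro ε hε
  obtain ⟨K₀, hK₀⟩ := eventually_atTop.1 (hn (ε / 2 * ‖z - 1‖) (by positivity))
  refine ⟨K₀, fun K hK => ?_⟩
  have hKpos : (0 : ℝ) < K := by exact_mod_cast (show 0 < K by omega)
  have h := hK₀ K (by omega) z hz
  rw [norm_mul] at h
  rw [dist_zero_right, norm_mul, norm_inv, Complex.norm_natCast, inv_mul_lt_iff₀ hKpos]
  have h' : ‖∑ k ∈ Finset.range K, z ^ n k‖ ≤ ε / 2 * K :=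
    le_of_mul_le_mul_left (by linarith) hz'
  nlinarith

theorem integral_centered_indicator_mul_conj {X : Type*} [MeasurableSpace X] (m : Measure X)
    [IsProbabilityMeasure m] {S : X → X} (hS : MeasurePreserving S m m) {A : Set X}
    (hA : MeasurableSet A) :
    ∫ x, (A.indicator 1 (S x) - (m.real A : ℂ)) *
      (starRingEnd ℂ) (A.indicator 1 x - (m.real A : ℂ)) ∂m =
      ((m.real (S ⁻¹' A ∩ A) - m.real A ^ 2 : ℝ) : ℂ) := by
  have hSA := hS.measurable hA
  have hpt : ∀ x, (A.indicator 1 (S x) - (m.real A : ℂ)) *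
      (starRingEnd ℂ) (A.indicator 1 x - (m.real A : ℂ)) =
      (S ⁻¹' A ∩ A).indicator 1 x - (m.real A : ℂ) * (S ⁻¹' A).indicator 1 x -
        (m.real A : ℂ) * A.indicator 1 x + (m.real A : ℂ) ^ 2 := by
    intro x
    by_cases h1 : S x ∈ A <;> by_cases h2 : x ∈ A <;>
      simp [Set.indicator, h1, h2] <;> ring
  have hint : ∀ B : Set X, MeasurableSet B → Integrable (B.indicator (1 : X → ℂ)) m := fun B hB =>
    (integrable_const (1 : ℂ)).indicator hB
  have hind : ∀ B : Set X, MeasurableSet B → ∫ x, B.indicator (1 : X → ℂ) x ∂m = m.real B :=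
    fun B hB => (integral_indicator_const (1 : ℂ) hB).trans (by simp)
  have hpre : m.real (S ⁻¹' A) = m.real A := by
    rw [measureReal_def, measureReal_def, hS.measure_preimage hA.nullMeasurableSet]
  have hi1 := hint _ (hSA.inter hA)
  have hi2 := (hint _ hSA).const_mul (m.real A : ℂ)
  have hi3 := (hint _ hA).const_mul (m.real A : ℂ)
  have hi12 : Integrable (fun x => (S ⁻¹' A ∩ A).indicator 1 x -
      (m.real A : ℂ) * (S ⁻¹' A).indicator 1 x) m := hi1.sub hi2
  have hi123 : Integrable (fun x => (S ⁻¹' A ∩ A).indicator 1 x -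
      (m.real A : ℂ) * (S ⁻¹' A).indicator 1 x - (m.real A : ℂ) * A.indicator 1 x) m :=
    hi12.sub hi3
  simp only [hpt]
  rw [integral_add hi123 (integrable_const _), integral_sub hi12 hi3,
    integral_sub hi1 hi2, integral_const_mul, integral_const_mul, hind _ (hSA.inter hA),
    hind _ hSA, hind _ hA, hpre]
  simp
  ring

/-- For a measure `σ` without an atom at `1`, the averages of the Fourier coefficients
`∫ z ^ (n k) dσ` tend to `σ {1} = 0`. When `σ` is the spectral measure of `f = 1_A - m A` and
`(n k)` is a rigidity sequence, they tend to `‖f‖² > 0`. -/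
theorem IsUniformlyErgodic.not_isRigiditySequence {n : ℕ → ℕ} (hn : IsUniformlyErgodic n) :
    ¬ IsRigiditySequence.{w} n := by
  rintro ⟨X, _, m, T, hW, hrig⟩
  obtain ⟨A, hA, hA0, hA1⟩ := hW.nontrivial
  have := hW.isProbabilityMeasure
  set c := m.real A with hc
  have hc0 : 0 < c := ENNReal.toReal_pos hA0.ne' (measure_ne_top m A)
  have hc1 : c < 1 := by
    have := (ENNReal.toReal_lt_toReal (measure_ne_top m A) ENNReal.one_ne_top).2 hA1
    simpa [hc, measureReal_def] using this
  set f : X → ℂ := fun x => A.indicator 1 x - (c : ℂ) with hf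
  have hfL : MemLp f 2 m :=
    (memLp_indicator_const 2 hA (1 : ℂ) (Or.inr (measure_ne_top m A))).sub (memLp_const _)
  have hf0 : ∫ x, f x ∂m = 0 := by
    have hi : Integrable (A.indicator (1 : X → ℂ)) m := (integrable_const (1 : ℂ)).indicator hA
    simp only [hf]
    rw [integral_sub hi (integrable_const _)]
    rw [show ∫ x, A.indicator (1 : X → ℂ) x ∂m = _ from integral_indicator_const (1 : ℂ) hA]
    simp [hc]
  obtain ⟨σ, ⟨hσ, hσf⟩, hσ0⟩ := hW.continuous_spectrum f hfL hf0
  -- along a rigidity sequence the Fourier coefficients of `σ` tend to its total mass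
  have hlim : Tendsto (fun k => ∫ z : Circle, (z : ℂ) ^ n k ∂σ) atTop
      (𝓝 ((c - c ^ 2 : ℝ) : ℂ)) := by
    have h1 : ∀ k, ∫ z : Circle, (z : ℂ) ^ n k ∂σ =
        ((m.real (T^[n k] ⁻¹' A ∩ A) - c ^ 2 : ℝ) : ℂ) := fun k => by
      rw [hσf]
      exact integral_centered_indicator_mul_conj m (hW.measurePreserving.iterate _) hA
    simp only [h1]
    refine (Complex.continuous_ofReal.tendsto _).comp (Tendsto.sub_const ?_ _)
    have h2 : Tendsto (fun k => m.real (symmDiff (T^[n k] ⁻¹' A) A)) atTop (𝓝 0) := by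
      have := (ENNReal.tendsto_toReal ENNReal.zero_ne_top).comp (hrig A hA)
      exact this
    refine tendsto_of_tendsto_of_tendsto_of_le_of_le (by simpa using h2.const_sub c)
      tendsto_const_nhds (fun k => ?_) (fun k => measureReal_mono Set.inter_subset_right)
    have h3 : m.real A ≤ m.real (T^[n k] ⁻¹' A ∩ A) + m.real (symmDiff (T^[n k] ⁻¹' A) A) := by
      refine (measureReal_mono ?_).trans (measureReal_union_le _ _)
      intro x hx
      by_cases hx' : x ∈ T^[n k] ⁻¹' A
      · exact Or.inl ⟨hx', hx⟩
      · exact Or.inr (Or.inr ⟨hx, hx'⟩)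
    simp only
    linarith
  have hlim' := hlim.cesaro_smul
  -- since `σ` has no atom at `1`, the averages tend to `0`
  have hzero : Tendsto (fun K : ℕ => ∫ z : Circle, (K : ℂ)⁻¹ * ∑ k ∈ Finset.range K,
      (z : ℂ) ^ n k ∂σ) atTop (𝓝 (∫ _ : Circle, (0 : ℂ) ∂σ)) := by
    refine tendsto_integral_of_dominated_convergence (fun _ => 1) (fun K => ?_)
      (integrable_const _) (fun K => ae_of_all _ fun z => ?_) ?_
    · exact (Continuous.aestronglyMeasurable (by fun_prop))
    · rcases Nat.eq_zero_or_pos K with rfl | hK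
      · simp
      have : (0 : ℝ) < K := by exact_mod_cast hK
      rw [norm_mul, norm_inv, Complex.norm_natCast, inv_mul_le_iff₀ this]
      refine (norm_sum_le _ _).trans ?_
      simp [Circle.norm_coe]
    · have : ∀ᵐ z ∂σ, z ≠ (1 : Circle) := by
        rw [ae_iff]
        simpa using hσ0 1
      filter_upwards [this] with z hz
      exact hn.tendsto_average_pow (Circle.norm_coe z) (by simpa [Circle.ext_iff] using hz)
  rw [integral_zero] at hzero
  have heq := tendsto_nhds_unique (hlim'.congr fun K => ?_) hzero
  · have : c - c ^ 2 = 0 := by exact_mod_cast heq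
    nlinarith
  · rw [integral_const_mul, integral_finsetSum, Complex.real_smul]
    · push_cast; rfl
    · intro k _
      exact Integrable.of_bound (Continuous.aestronglyMeasurable (by fun_prop)) 1
        (ae_of_all _ fun z => by simp [Circle.norm_coe])

/-! ### A group topology in which a given sequence tends to zero -/

/-- The set of `0` and all `± a k` with `k ≥ n`. -/
def signedTail (a : ℕ → ℤ) (n : ℕ) : Set ℤ :=
  {x | x = 0 ∨ ∃ k, n ≤ k ∧ (x = a k ∨ x = -a k)}

open scoped Pointwise in
/-- The sumset `signedTail a (f 0) + ⋯ + signedTail a (f (j - 1))`. -/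
def tailSumset (a : ℕ → ℤ) (f : ℕ → ℕ) : ℕ → Set ℤ
  | 0 => {0}
  | j + 1 => tailSumset a f j + signedTail a (f j)

section NullpotentTopology

open scoped Pointwise

variable {a : ℕ → ℤ}

theorem zero_mem_signedTail (n : ℕ) : (0 : ℤ) ∈ signedTail a n := Or.inl rfl

theorem neg_mem_signedTail {n : ℕ} {x : ℤ} (hx : x ∈ signedTail a n) : -x ∈ signedTail a n := by
  rcases hx with rfl | ⟨k, hk, rfl | rfl⟩
  · exact Or.inl neg_zero
  · exact Or.inr ⟨k, hk, Or.inr rfl⟩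
  · exact Or.inr ⟨k, hk, Or.inl (neg_neg _)⟩

theorem signedTail_anti : Antitone (signedTail a) := by
  rintro n n' h x (rfl | ⟨k, hk, hx⟩)
  · exact Or.inl rfl
  · exact Or.inr ⟨k, h.trans hk, hx⟩

theorem tailSumset_mono_right (f : ℕ → ℕ) : Monotone (tailSumset a f) :=
  monotone_nat_of_le_succ fun _ x hx => ⟨x, hx, 0, zero_mem_signedTail _, add_zero x⟩

theorem tailSumset_anti_left {f g : ℕ → ℕ} (h : f ≤ g) (j : ℕ) :
    tailSumset a g j ⊆ tailSumset a f j := by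
  induction j with
  | zero => exact subset_rfl
  | succ j ih => exact Set.add_subset_add ih (signedTail_anti (h j))

theorem neg_mem_tailSumset {f : ℕ → ℕ} {j : ℕ} {x : ℤ} (hx : x ∈ tailSumset a f j) :
    -x ∈ tailSumset a f j := by
  induction j generalizing x with
  | zero =>
    obtain rfl : x = 0 := hx
    exact neg_zero
  | succ j ih =>
    obtain ⟨y, hy, z, hz, rfl⟩ := hx
    exact ⟨-y, ih hy, -z, neg_mem_signedTail hz, (neg_add y z).symm⟩

/-- Interleaving the summands of two sums: this gives the continuity of addition at `0` for the
topology with the neighbourhoods `⋃ j, tailSumset a f j`. -/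
theorem tailSumset_add_self_subset (f : ℕ → ℕ) (j : ℕ) :
    tailSumset a (fun i => max (f (2 * i)) (f (2 * i + 1))) j +
      tailSumset a (fun i => max (f (2 * i)) (f (2 * i + 1))) j ⊆ tailSumset a f (2 * j) := by
  induction j with
  | zero => simp [tailSumset]
  | succ j ih =>
    rintro _ ⟨_, ⟨x, hx, y, hy, rfl⟩, _, ⟨x', hx', y', hy', rfl⟩, rfl⟩
    refine ⟨x + x' + y, ⟨x + x', ih ⟨x, hx, x', hx', rfl⟩, y, ?_, rfl⟩, y', ?_, ?_⟩
    · exact signedTail_anti (le_max_left _ _) hy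
    · exact signedTail_anti (le_max_right _ _) hy'
    · simp only
      ring

/-- `F` contains every integer that differs from elements of `F` by sums of boundedly many terms
`± a k` with `k` arbitrarily large. -/
def IsTailClosed (a : ℕ → ℤ) (F : Set ℤ) : Prop :=
  ∀ (m : ℕ) (x : ℤ), (∀ n, x ∈ F + tailSumset a (fun _ => n) m) → x ∈ F

/-- A given integer `x` cannot use summands from `signedTail a N` with unbounded indices unless it
already lies in `F`; so only finitely many of these summands matter, and one of them works for
all `n`. -/
theorem IsTailClosed.add_signedTail {F : Set ℤ} (hF : IsTailClosed a F) (N : ℕ) :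
    IsTailClosed a (F + signedTail a N) := by
  intro m x hx
  by_cases hall : ∀ n, x ∈ F + tailSumset a (fun _ => n) (m + 1)
  · exact ⟨x, hF _ _ hall, 0, zero_mem_signedTail _, add_zero x⟩
  push Not at hall
  obtain ⟨n', hn'⟩ := hall
  -- the summand from the tail `N` has index below `n'`
  have hfin : (signedTail a N \ signedTail a n').Finite := by
    refine (((Set.finite_lt_nat n').image a).union
      ((Set.finite_lt_nat n').image fun k => -a k)).subset ?_
    rintro e ⟨he, he'⟩
    rcases he with rfl | ⟨k, -, hk⟩
    · exact absurd (zero_mem_signedTail _) he'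
    have hkn : k < n' := by
      by_contra! hle
      exact he' (Or.inr ⟨k, hle, hk⟩)
    rcases hk with rfl | rfl
    · exact Or.inl ⟨k, hkn, rfl⟩
    · exact Or.inr ⟨k, hkn, rfl⟩
  have hex : ∀ n, ∃ e ∈ signedTail a N \ signedTail a n',
      x - e ∈ F + tailSumset a (fun _ => n) m := by
    intro n
    obtain ⟨_, ⟨u, hu, e, he, rfl⟩, s, hs, rfl⟩ := hx (max n n')
    refine ⟨e, ⟨he, fun he' => hn' ?_⟩, u, hu, s,
      tailSumset_anti_left (fun _ => le_max_left _ _) _ hs, by simp only; ring⟩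
    exact ⟨u, hu, s + e, ⟨s, tailSumset_anti_left (fun _ => le_max_right _ _) _ hs, e, he', rfl⟩,
      by simp only; ring⟩
  -- by the pigeonhole principle, one such summand works for all `n`
  have hpig : ∃ e ∈ signedTail a N \ signedTail a n',
      ∀ n, x - e ∈ F + tailSumset a (fun _ => n) m := by
    by_contra! hcon
    choose! b hb using hcon
    obtain ⟨M, hM⟩ := (hfin.image b).bddAbove
    obtain ⟨e, he, hmem⟩ := hex M
    exact hb e he (Set.add_subset_add subset_rfl
      (tailSumset_anti_left (fun _ => hM ⟨e, he, rfl⟩) _) hmem)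
  obtain ⟨e, he, h⟩ := hpig
  exact ⟨x - e, hF _ _ h, e, he.1, sub_add_cancel x e⟩

/-- A non-zero integer is excluded from one of the basic neighbourhoods of `0`. The values of `f`
are chosen one after another, keeping the partial sumset tail-closed so that the next choice is
possible. -/
theorem exists_forall_notMem_tailSumset
    (h : ∀ g : ℤ, g ≠ 0 → ∀ m : ℕ, ∃ n, g ∉ tailSumset a (fun _ => n) m) {g : ℤ} (hg : g ≠ 0) :
    ∃ f : ℕ → ℕ, ∀ j, g ∉ tailSumset a f j := by
  have h0 : IsTailClosed a {0} := by
    intro m x hx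
    by_contra hx0
    obtain ⟨n, hn⟩ := h x hx0 m
    exact hn (by simpa using hx n)
  have hstep : ∀ F : {F : Set ℤ // IsTailClosed a F ∧ g ∉ F}, ∃ n, g ∉ F.1 + signedTail a n := by
    rintro ⟨F, hF, hgF⟩
    by_contra! hcon
    exact hgF (hF 1 g fun n => by simpa [tailSumset] using hcon n)
  choose N hN using hstep
  let seq : ℕ → {F : Set ℤ // IsTailClosed a F ∧ g ∉ F} := fun j =>
    Nat.rec ⟨{0}, h0, hg⟩ (fun _ F => ⟨F.1 + signedTail a (N F), F.2.1.add_signedTail _, hN F⟩) j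
  have hseq : ∀ j, tailSumset a (fun i => N (seq i)) j = (seq j).1 := by
    intro j
    induction j with
    | zero => rfl
    | succ j ih =>
      change tailSumset a _ j + _ = _
      rw [ih]
  exact ⟨fun i => N (seq i), fun j => by rw [hseq]; exact (seq j).2.2⟩

/-- A criterion of Protasov and Zelenyuk: `a` tends to `0` in a Hausdorff group topology as soon as
no non-zero integer is, for some `m`, a sum of at most `m` terms `± a k` with arbitrarily large
indices. The sets `⋃ j, tailSumset a f j` are the basic neighbourhoods of `0`. -/
theorem isNullpotent_of_forall_notMem_tailSumset
    (h : ∀ g : ℤ, g ≠ 0 → ∀ m : ℕ, ∃ n, g ∉ tailSumset a (fun _ => n) m) : IsNullpotent a := by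
  let B : AddGroupFilterBasis ℤ := addGroupFilterBasisOfComm
    (Set.range fun f : ℕ → ℕ => ⋃ j, tailSumset a f j) (Set.range_nonempty _)
    (by
      rintro _ _ ⟨f, rfl⟩ ⟨g, rfl⟩
      refine ⟨_, ⟨f ⊔ g, rfl⟩, Set.subset_inter ?_ ?_⟩
      · exact Set.iUnion_mono fun j => tailSumset_anti_left le_sup_left j
      · exact Set.iUnion_mono fun j => tailSumset_anti_left le_sup_right j)
    (by
      rintro _ ⟨f, rfl⟩
      exact Set.mem_iUnion.2 ⟨0, rfl⟩)
    (by
      rintro _ ⟨f, rfl⟩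
      refine ⟨_, ⟨fun i => max (f (2 * i)) (f (2 * i + 1)), rfl⟩, ?_⟩
      rintro _ ⟨x, hx, y, hy, rfl⟩
      obtain ⟨i, hi⟩ := Set.mem_iUnion.1 hx
      obtain ⟨j, hj⟩ := Set.mem_iUnion.1 hy
      exact Set.mem_iUnion.2 ⟨2 * max i j, tailSumset_add_self_subset f _
        ⟨x, tailSumset_mono_right _ (le_max_left _ _) hi, y,
          tailSumset_mono_right _ (le_max_right _ _) hj, rfl⟩⟩)
    (by
      rintro _ ⟨f, rfl⟩
      refine ⟨_, ⟨f, rfl⟩, fun x hx => ?_⟩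
      obtain ⟨i, hi⟩ := Set.mem_iUnion.1 hx
      exact Set.mem_iUnion.2 ⟨i, neg_mem_tailSumset hi⟩)
  have hB : ∀ f : ℕ → ℕ, (⋃ j, tailSumset a f j) ∈ B := fun f => ⟨f, rfl⟩
  let := B.topology
  have : IsTopologicalAddGroup ℤ := B.isTopologicalAddGroup
  refine ⟨B.topology, ?_, inferInstance, ?_⟩
  · refine IsTopologicalAddGroup.t2Space_of_zero_sep fun g hg => ?_
    obtain ⟨f, hf⟩ := exists_forall_notMem_tailSumset h hg
    exact ⟨_, B.mem_nhds_zero (hB f), by simpa using hf⟩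
  · refine B.nhds_zero_hasBasis.tendsto_right_iff.2 ?_
    rintro _ ⟨f, rfl⟩
    filter_upwards [eventually_ge_atTop (f 0)] with k hk
    exact Set.mem_iUnion.2 ⟨1, 0, rfl, a k, Or.inr ⟨k, hk, Or.inl rfl⟩, zero_add _⟩

end NullpotentTopology

/-! ### Relations between the terms of a sequence -/

/-- Collecting equal terms in a sum of `m` terms `0` or `± b k`. -/
theorem exists_finsupp_of_mem_tailSumset {b : ℕ → ℕ} (hb : ∀ k, k ≤ b k) {n m : ℕ} {g : ℤ}
    (hg : g ∈ tailSumset (fun k => (b k : ℤ)) (fun _ => n) m) :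
    ∃ c : ℕ →₀ ℤ, (∀ i ∈ c.support, n ≤ i ∧ i ∈ Set.range b) ∧ c.support.card ≤ m ∧
      (∀ i, |c i| ≤ m) ∧ c.sum (fun i x => x * (i : ℤ)) = g := by
  induction m generalizing g with
  | zero =>
    obtain rfl : g = 0 := hg
    exact ⟨0, by simp⟩
  | succ m ih =>
    obtain ⟨u, hu, e, he, rfl⟩ := hg
    obtain ⟨c, hc1, hc2, hc3, hc4⟩ := ih hu
    have hcase : e = 0 ∨ ∃ k, n ≤ k ∧ ∃ s : ℤ, |s| = 1 ∧ e = s * (b k : ℤ) := by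
      rcases he with rfl | ⟨k, hk, rfl | rfl⟩
      · exact Or.inl rfl
      · exact Or.inr ⟨k, hk, 1, by simp, by simp⟩
      · exact Or.inr ⟨k, hk, -1, by simp, by simp⟩
    rcases hcase with rfl | ⟨k, hk, s, hs, rfl⟩
    · refine ⟨c, hc1, hc2.trans (Nat.le_succ m), fun i => (hc3 i).trans (by simp), ?_⟩
      simp [hc4]
    · have hsub : (c + Finsupp.single (b k) s).support ⊆ insert (b k) c.support := by
        intro i hi
        rcases Finset.mem_union.1 (Finsupp.support_add hi) with h | h
        · exact Finset.mem_insert_of_mem h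
        · rw [Finset.mem_singleton.1 (Finsupp.support_single_subset h)]
          exact Finset.mem_insert_self _ _
      refine ⟨c + Finsupp.single (b k) s, fun i hi => ?_, ?_, fun i => ?_, ?_⟩
      · rcases Finset.mem_insert.1 (hsub hi) with rfl | h
        · exact ⟨hk.trans (hb k), k, rfl⟩
        · exact hc1 i h
      · exact (Finset.card_le_card hsub).trans
          ((Finset.card_insert_le _ _).trans (Nat.succ_le_succ hc2))
      · rw [Finsupp.add_apply]
        refine (abs_add_le _ _).trans ?_
        push_cast
        refine add_le_add (hc3 i) ?_
        rw [Finsupp.single_apply]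
        split_ifs <;> simp [hs]
      · rw [Finsupp.sum_add_index' (by simp) (fun _ _ _ => add_mul _ _ _), hc4,
          Finsupp.sum_single_index (by simp)]

/-- `g` is an integer combination, with coefficients bounded by `m`, of `k + 2` distinct elements of
`A`, the second largest of which is `L`; the coefficient of the largest one is non-zero. -/
def HasRelationAt (A : Set ℕ) (g : ℤ) (m k L : ℕ) : Prop :=
  L ∈ A ∧ ∃ f : Fin k → ℕ, Function.Injective f ∧ (∀ i, f i ∈ A ∧ f i < L) ∧
    ∃ c₀ c₁ : ℤ, ∃ c : Fin k → ℤ, c₀ ≠ 0 ∧ |c₀| ≤ m ∧ |c₁| ≤ m ∧ (∀ i, |c i| ≤ m) ∧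
      ∃ w ∈ A, L < w ∧ c₀ * w + c₁ * L + ∑ i, c i * f i = g

/-- Since all terms exceed `|g|`, a combination that is equal to `g` has at least two terms. -/
theorem exists_hasRelationAt {b : ℕ → ℕ} (hb : ∀ k, k ≤ b k) {n m : ℕ} {g : ℤ}
    (hg0 : g ≠ 0) (hgn : |g| < n)
    (hg : g ∈ tailSumset (fun k => (b k : ℤ)) (fun _ => n) m) :
    ∃ k ≤ m, ∃ L, n ≤ L ∧ HasRelationAt (Set.range b) g m k L := by
  obtain ⟨c, hc1, hc2, hc3, hc4⟩ := exists_finsupp_of_mem_tailSumset hb hg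
  have hne : c.support.Nonempty := by
    rw [Finset.nonempty_iff_ne_empty]
    intro h
    rw [Finsupp.sum, h, Finset.sum_empty] at hc4
    exact hg0 hc4.symm
  set w := c.support.max' hne with hw
  have hwmem : w ∈ c.support := c.support.max'_mem hne
  have hcw : c w ≠ 0 := Finsupp.mem_support_iff.1 hwmem
  rw [Finsupp.sum, ← Finset.add_sum_erase _ _ hwmem] at hc4
  rcases (c.support.erase w).eq_empty_or_nonempty with he | hne'
  · rw [he, Finset.sum_empty, add_zero] at hc4
    have h1 : (w : ℤ) ≤ |g| := by
      rw [← hc4, abs_mul, Nat.abs_cast]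
      exact le_mul_of_one_le_left (by positivity) (Int.one_le_abs hcw)
    have h2 : (n : ℤ) ≤ w := by exact_mod_cast (hc1 w hwmem).1
    omega
  set L := (c.support.erase w).max' hne' with hL
  have hLmem : L ∈ c.support.erase w := (c.support.erase w).max'_mem hne'
  have hLsup : L ∈ c.support := Finset.mem_of_mem_erase hLmem
  rw [← Finset.add_sum_erase _ _ hLmem] at hc4
  set R := (c.support.erase w).erase L with hR
  have hRsup : ∀ i ∈ R, i ∈ c.support := fun i hi =>
    Finset.mem_of_mem_erase (Finset.mem_of_mem_erase hi)
  have hsum : ∑ i ∈ R, c i * (i : ℤ) =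
      ∑ i, c (R.orderEmbOfFin rfl i) * ((R.orderEmbOfFin rfl i : ℕ) : ℤ) := by
    conv_lhs => rw [← Finset.map_orderEmbOfFin_univ R rfl, Finset.sum_map]
    rfl
  refine ⟨R.card, (Finset.card_le_card hRsup).trans hc2, L, (hc1 L hLsup).1, (hc1 L hLsup).2,
    R.orderEmbOfFin rfl, (R.orderEmbOfFin rfl).injective, fun i => ?_, c w, c L,
    fun i => c (R.orderEmbOfFin rfl i), hcw, hc3 w, hc3 L, fun i => hc3 _, w, (hc1 w hwmem).2,
    ?_, ?_⟩
  · have hi := R.orderEmbOfFin_mem rfl i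
    refine ⟨(hc1 _ (hRsup _ hi)).2, lt_of_le_of_ne ?_ (Finset.ne_of_mem_erase hi)⟩
    exact Finset.le_max' _ _ (Finset.mem_of_mem_erase hi)
  · exact lt_of_le_of_ne (Finset.le_max' _ _ hLsup) (Finset.ne_of_mem_erase hLmem)
  · rw [← hsum, ← hc4, add_assoc]

theorem isNullpotent_of_eventually_not_hasRelationAt {b : ℕ → ℕ} (hb : ∀ k, k ≤ b k)
    (h : ∀ (g : ℤ) (m k : ℕ), ∀ᶠ L in atTop, ¬ HasRelationAt (Set.range b) g m k L) :
    IsNullpotent (fun k => (b k : ℤ)) := by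
  refine isNullpotent_of_forall_notMem_tailSumset fun g hg m => ?_
  have hall : ∀ᶠ L in atTop, ∀ k ∈ Finset.range (m + 1), ¬ HasRelationAt (Set.range b) g m k L :=
    (Finset.eventually_all _).2 fun k _ => h g m k
  obtain ⟨n₀, hn₀⟩ := eventually_atTop.1 hall
  refine ⟨max n₀ (g.natAbs + 1), fun hmem => ?_⟩
  obtain ⟨k, hk, L, hL, hrel⟩ := exists_hasRelationAt hb hg
    (by rw [Int.abs_eq_natAbs]; omega) hmem
  exact hn₀ L ((le_max_left _ _).trans hL) k (Finset.mem_range.2 (by omega)) hrel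

/-! ### The random set satisfies few relations -/

theorem measureReal_forall_mem_randomSet {Ω : Type u} [MeasurableSpace Ω] {P : Measure Ω}
    [IsProbabilityMeasure P] {p : ℕ → ℝ} {ξ : ℕ → Ω → ℝ}
    (hξ_indep : iIndepFun (fun n : ℕ => ξ (n + 1)) P)
    (hξ_one : ∀ n : ℕ, 1 ≤ n → P.real {ω | ξ n ω = 1} = p n)
    {S : Finset ℕ} (hS : ∀ x ∈ S, 1 ≤ x) :
    P.real {ω | ∀ x ∈ S, x ∈ randomSet ξ ω} = ∏ x ∈ S, p x := by
  have hinj : Set.InjOn Nat.pred (S : Set ℕ) := by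
    intro x hx y hy hxy
    have := hS x hx
    have := hS y hy
    simp only [Nat.pred_eq_sub_one] at hxy
    omega
  have h := hξ_indep.measure_inter_preimage_eq_mul (S.image Nat.pred) (sets := fun _ => {(1 : ℝ)})
    (fun _ _ => measurableSet_singleton _)
  rw [Finset.prod_image hinj] at h
  have hset : {ω | ∀ x ∈ S, x ∈ randomSet ξ ω} =
      ⋂ i ∈ S.image Nat.pred, ξ (i + 1) ⁻¹' {(1 : ℝ)} := by
    ext ω
    simp only [Set.mem_ofPred_eq, Set.mem_iInter, Finset.mem_image, Set.mem_preimage,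
      Set.mem_singleton_iff, randomSet]
    constructor
    · rintro h _ ⟨x, hx, rfl⟩
      have := (h x hx).2
      rwa [← Nat.succ_pred_eq_of_pos (hS x hx)] at this
    · intro h x hx
      have := h _ ⟨x, hx, rfl⟩
      refine ⟨hS x hx, ?_⟩
      rwa [← Nat.succ_eq_add_one, Nat.succ_pred_eq_of_pos (hS x hx)] at this
  rw [measureReal_def, hset, h, ENNReal.toReal_prod]
  refine Finset.prod_congr rfl fun x hx => ?_
  have hx1 : x.pred + 1 = x := Nat.succ_pred_eq_of_pos (hS x hx)
  rw [hx1, ← hξ_one x (hS x hx)]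
  rfl

/-- First moment bound. The `k` smallest elements and all coefficients determine the largest
element, so this element contributes, as does `L`, only a factor `D` and no summation. -/
theorem measureReal_hasRelationAt_le {Ω : Type u} [MeasurableSpace Ω] {P : Measure Ω}
    [IsProbabilityMeasure P] {p : ℕ → ℝ} {ξ : ℕ → Ω → ℝ} (hp : ∀ n : ℕ, 1 ≤ n → 0 < p n)
    (hξ_indep : iIndepFun (fun n : ℕ => ξ (n + 1)) P)
    (hξ_one : ∀ n : ℕ, 1 ≤ n → P.real {ω | ξ n ω = 1} = p n)
    (g : ℤ) (m k : ℕ) {L : ℕ} {D : ℝ} (hD : ∀ n, L ≤ n → p n ≤ D) :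
    P.real {ω | HasRelationAt (randomSet ξ ω) g m k L} ≤
      (2 * m + 1) ^ (k + 2) * (D ^ 2 * (∑ n ∈ Finset.Ico 1 L, p n) ^ k) := by
  rcases Nat.eq_zero_or_pos L with rfl | hL
  · have hempty : {ω | HasRelationAt (randomSet ξ ω) g m k 0} = ∅ := by
      ext ω
      simp only [Set.mem_ofPred_eq, Set.mem_empty_iff_false, iff_false]
      rintro ⟨⟨h, -⟩, -⟩
      omega
    rw [hempty, measureReal_empty]
    simp only [Finset.Ico_eq_empty_of_le, zero_le, Finset.sum_empty]
    positivity
  have hD0 : 0 ≤ D := (hp L hL).le.trans (hD L le_rfl)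
  set I : Finset ℤ := Finset.Icc (-(m : ℤ)) m with hI
  have hIcard : (I.card : ℝ) = 2 * m + 1 := by
    rw [hI, Int.card_Icc]
    have : ((m : ℤ) + 1 - -(m : ℤ)).toNat = 2 * m + 1 := by omega
    rw [this]
    push_cast
    ring
  set Fs : Finset (Fin k → ℕ) := Fintype.piFinset fun _ => Finset.Ico 1 L with hFs
  set Cs : Finset (Fin k → ℤ) := Fintype.piFinset fun _ => I with hCs
  set Ev : (Fin k → ℕ) × ℤ × ℤ × (Fin k → ℤ) → Set Ω := fun t =>
    {ω | L ∈ randomSet ξ ω ∧ Function.Injective t.1 ∧ t.2.1 ≠ 0 ∧ (∀ i, t.1 i ∈ randomSet ξ ω) ∧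
      ∃ w ∈ randomSet ξ ω, L < w ∧
        t.2.1 * w + t.2.2.1 * L + ∑ i, t.2.2.2 i * t.1 i = g} with hEv
  have hsub : {ω | HasRelationAt (randomSet ξ ω) g m k L} ⊆
      ⋃ t ∈ Fs ×ˢ I ×ˢ I ×ˢ Cs, Ev t := by
    rintro ω ⟨hLA, f, hf, hfA, c₀, c₁, c, hc0, hc₀, hc₁, hc, w, hw, hLw, hsum⟩
    refine Set.mem_iUnion₂.2 ⟨(f, c₀, c₁, c), ?_, hLA, hf, hc0, fun i => (hfA i).1,
      w, hw, hLw, hsum⟩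
    simp only [Finset.mem_product, hFs, hCs, Fintype.mem_piFinset, hI, Finset.mem_Icc,
      Finset.mem_Ico]
    exact ⟨fun i => ⟨(hfA i).1.1, (hfA i).2⟩, abs_le.1 hc₀, abs_le.1 hc₁,
      fun i => abs_le.1 (hc i)⟩
  have hbound : ∀ t ∈ Fs ×ˢ I ×ˢ I ×ˢ Cs, P.real (Ev t) ≤ D ^ 2 * ∏ i, p (t.1 i) := by
    rintro ⟨f, c₀, c₁, c⟩ ht
    simp only [Finset.mem_product, hFs, Fintype.mem_piFinset, Finset.mem_Ico] at ht
    have hf1 := ht.1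
    have hprod0 : 0 ≤ ∏ i, p (f i) := Finset.prod_nonneg fun i _ => (hp _ (hf1 i).1).le
    by_cases hex : Function.Injective f ∧ c₀ ≠ 0 ∧ ∃ w : ℕ, L < w ∧
        c₀ * w + c₁ * L + ∑ i, c i * f i = g
    · obtain ⟨hinj, hc0, w, hLw, hw⟩ := hex
      -- the largest term is determined by all other data
      have hsub' : Ev (f, c₀, c₁, c) ⊆
          {ω | ∀ x ∈ insert w (insert L (Finset.univ.image f)), x ∈ randomSet ξ ω} := by
        rintro ω ⟨hLA, -, -, hfA, w', hw'A, -, hw'⟩ x hx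
        simp only at hfA hw'
        have hww : w' = w := by
          have : c₀ * (w' : ℤ) = c₀ * w := by linarith
          exact_mod_cast mul_left_cancel₀ hc0 this
        simp only [Finset.mem_insert, Finset.mem_image, Finset.mem_univ, true_and] at hx
        rcases hx with rfl | rfl | ⟨i, rfl⟩
        · exact hww ▸ hw'A
        · exact hLA
        · exact hfA i
      refine (measureReal_mono hsub').trans ?_
      rw [measureReal_forall_mem_randomSet hξ_indep hξ_one]
      · rw [Finset.prod_insert, Finset.prod_insert, Finset.prod_image hinj.injOn, ← mul_assoc, sq]
        · gcongr
          · exact (hp L hL).le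
          · exact hD w hLw.le
          · exact hD L le_rfl
        · simp only [Finset.mem_image, Finset.mem_univ, true_and, not_exists]
          exact fun i => (hf1 i).2.ne
        · simp only [Finset.mem_insert, Finset.mem_image, Finset.mem_univ, true_and, not_or,
            not_exists]
          exact ⟨hLw.ne', fun i => ((hf1 i).2.trans hLw).ne⟩
      · intro x hx
        simp only [Finset.mem_insert, Finset.mem_image, Finset.mem_univ, true_and] at hx
        rcases hx with rfl | rfl | ⟨i, rfl⟩
        · omega
        · exact hL
        · exact (hf1 i).1
    · have hempty : Ev (f, c₀, c₁, c) = ∅ := by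
        refine Set.eq_empty_of_forall_notMem fun ω hω => hex ?_
        obtain ⟨-, hinj, hc0, -, w, -, hLw, hw⟩ := hω
        exact ⟨hinj, hc0, w, hLw, hw⟩
      rw [hempty, measureReal_empty]
      positivity
  calc P.real {ω | HasRelationAt (randomSet ξ ω) g m k L}
      ≤ P.real (⋃ t ∈ Fs ×ˢ I ×ˢ I ×ˢ Cs, Ev t) :=
      measureReal_mono hsub (measure_ne_top _ _)
    _ ≤ ∑ t ∈ Fs ×ˢ I ×ˢ I ×ˢ Cs, P.real (Ev t) := measureReal_biUnion_finset_le _ _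
    _ ≤ ∑ t ∈ Fs ×ˢ I ×ˢ I ×ˢ Cs, D ^ 2 * ∏ i, p (t.1 i) := Finset.sum_le_sum hbound
    _ = (2 * m + 1) ^ (k + 2) * (D ^ 2 * (∑ n ∈ Finset.Ico 1 L, p n) ^ k) := by
      have hpow : (∑ n ∈ Finset.Ico 1 L, p n) ^ k = ∑ f ∈ Fs, ∏ i, p (f i) := by
        rw [hFs, ← Finset.prod_univ_sum (fun _ : Fin k => Finset.Ico 1 L) (fun _ n => p n)]
        simp
      rw [Finset.sum_product, hpow, Finset.mul_sum, Finset.mul_sum]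
      refine Finset.sum_congr rfl fun f _ => ?_
      change ∑ _t ∈ I ×ˢ I ×ˢ Cs, D ^ 2 * ∏ i, p (f i) = _
      rw [Finset.sum_const, Finset.card_product, Finset.card_product, hCs,
        Fintype.card_piFinset_const, nsmul_eq_mul]
      push_cast
      rw [hIcard]
      ring

/-- The loss of a second factor `L ^ ε`, which comes from bounding the logarithm, is harmless. -/
theorem sum_Ico_le_of_le_rpow {p : ℕ → ℝ} {C ε : ℝ} (hC : 0 ≤ C) (hε : 0 < ε)
    (hpC : ∀ n : ℕ, 1 ≤ n → p n ≤ C * (n : ℝ) ^ (-(1 - ε))) {L : ℕ} (hL : 1 ≤ L) :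
    ∑ n ∈ Finset.Ico 1 L, p n ≤ C * (1 + 1 / ε) * (L : ℝ) ^ (2 * ε) := by
  have hL0 : (1 : ℝ) ≤ L := by exact_mod_cast hL
  have h1 : ∀ n ∈ Finset.Ico 1 L, p n ≤ C * (L : ℝ) ^ ε * (n : ℝ)⁻¹ := by
    intro n hn
    rw [Finset.mem_Ico] at hn
    have hn0 : (0 : ℝ) < n := by exact_mod_cast hn.1
    refine (hpC n hn.1).trans ?_
    rw [show -(1 - ε) = ε + -1 by ring, Real.rpow_add hn0, Real.rpow_neg_one, mul_assoc]
    gcongr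
    exact hn.2.le
  have h2 : ∑ n ∈ Finset.Ico 1 L, (n : ℝ)⁻¹ ≤ 1 + Real.log L := by
    refine le_trans ?_ (harmonic_le_one_add_log L)
    rw [harmonic_eq_sum_Icc]
    push_cast
    refine Finset.sum_le_sum_of_subset_of_nonneg ?_ fun i _ _ => by positivity
    intro i hi
    simp only [Finset.mem_Ico, Finset.mem_Icc] at hi ⊢
    omega
  have h3 : Real.log L ≤ (L : ℝ) ^ ε / ε := Real.log_le_rpow_div (by positivity) hε
  have h4 : (1 : ℝ) ≤ (L : ℝ) ^ ε := Real.one_le_rpow hL0 hε.le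
  calc ∑ n ∈ Finset.Ico 1 L, p n ≤ ∑ n ∈ Finset.Ico 1 L, C * (L : ℝ) ^ ε * (n : ℝ)⁻¹ :=
        Finset.sum_le_sum h1
    _ = C * (L : ℝ) ^ ε * ∑ n ∈ Finset.Ico 1 L, (n : ℝ)⁻¹ := by rw [Finset.mul_sum]
    _ ≤ C * (L : ℝ) ^ ε * ((L : ℝ) ^ ε + (L : ℝ) ^ ε / ε) := by gcongr; linarith
    _ = C * (1 + 1 / ε) * (L : ℝ) ^ (2 * ε) := by
      rw [two_mul, Real.rpow_add (by positivity)]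
      ring

theorem exists_forall_le_rpow {p : ℕ → ℝ} {ε : ℝ}
    (h : p =O[atTop] fun n : ℕ => 1 / (n : ℝ) ^ (1 - ε)) :
    ∃ C : ℝ, 0 ≤ C ∧ ∀ n : ℕ, 1 ≤ n → p n ≤ C * (n : ℝ) ^ (-(1 - ε)) := by
  obtain ⟨C, hC⟩ := h.bound
  obtain ⟨n₀, hn₀⟩ := eventually_atTop.1 hC
  set C' : ℝ := ∑ n ∈ Finset.range n₀, |p n| * (n : ℝ) ^ (1 - ε) with hC'
  have hC'0 : 0 ≤ C' := Finset.sum_nonneg fun _ _ => by positivity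
  refine ⟨max C 0 + C', by positivity, fun n hn => ?_⟩
  have hn0 : (0 : ℝ) < n := by exact_mod_cast hn
  have hpos : 0 < (n : ℝ) ^ (1 - ε) := Real.rpow_pos_of_pos hn0 _
  rw [Real.rpow_neg hn0.le, ← div_eq_mul_inv, le_div_iff₀ hpos]
  rcases lt_or_ge n n₀ with hlt | hge
  · have h1 : |p n| * (n : ℝ) ^ (1 - ε) ≤ C' :=
      Finset.single_le_sum (f := fun n : ℕ => |p n| * (n : ℝ) ^ (1 - ε))
        (fun _ _ => by positivity) (Finset.mem_range.2 hlt)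
    have h2 : p n * (n : ℝ) ^ (1 - ε) ≤ |p n| * (n : ℝ) ^ (1 - ε) := by
      gcongr
      exact le_abs_self _
    have := le_max_right C 0
    linarith
  · have h1 := hn₀ n hge
    rw [Real.norm_eq_abs, Real.norm_eq_abs, abs_of_pos (one_div_pos.2 hpos), mul_one_div,
      le_div_iff₀ hpos] at h1
    have h2 : p n * (n : ℝ) ^ (1 - ε) ≤ |p n| * (n : ℝ) ^ (1 - ε) := by
      gcongr
      exact le_abs_self _
    have := le_max_left C 0
    linarith

/-- Almost surely, for given `g`, `m` and `k` there is no relation whose second largest term `L` is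
large, by the Borel–Cantelli lemma. -/
theorem ae_eventually_not_hasRelationAt {Ω : Type u} [MeasurableSpace Ω] {P : Measure Ω}
    [IsProbabilityMeasure P] {p : ℕ → ℝ} {ξ : ℕ → Ω → ℝ} (hp : ∀ n : ℕ, 1 ≤ n → 0 < p n)
    (hξ_indep : iIndepFun (fun n : ℕ => ξ (n + 1)) P)
    (hξ_one : ∀ n : ℕ, 1 ≤ n → P.real {ω | ξ n ω = 1} = p n)
    (h3 : ∀ ε : ℝ, 0 < ε → ε < 1 → p =O[atTop] fun n : ℕ => 1 / (n : ℝ) ^ (1 - ε)) :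
    ∀ᵐ ω ∂P, ∀ (g : ℤ) (m k : ℕ), ∀ᶠ L in atTop, ¬ HasRelationAt (randomSet ξ ω) g m k L := by
  simp only [ae_all_iff]
  intro g m k
  -- with this exponent the event at `L` has probability `O(L ^ (-3 / 2))`
  set ε : ℝ := 1 / (4 * (k + 1)) with hε
  have hε0 : 0 < ε := by positivity
  have hkε : ε * (k + 1) = 1 / 4 := by rw [hε]; field_simp
  have hε1 : ε < 1 := by
    have : ε ≤ ε * (k + 1) := le_mul_of_one_le_right hε0.le (by simp)
    linarith
  obtain ⟨C, hC0, hC⟩ := exists_forall_le_rpow (h3 ε hε0 hε1)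
  set K : ℝ := (2 * m + 1) ^ (k + 2) * (C ^ 2 * (C * (1 + 1 / ε)) ^ k) with hK
  have hle : ∀ L : ℕ, 1 ≤ L → P.real {ω | HasRelationAt (randomSet ξ ω) g m k L} ≤
      K * (L : ℝ) ^ (-(3 / 2) : ℝ) := by
    intro L hL
    have hL0 : (0 : ℝ) < L := by exact_mod_cast hL
    have hD : ∀ n, L ≤ n → p n ≤ C * (L : ℝ) ^ (-(1 - ε)) := by
      intro n hn
      refine (hC n (hL.trans hn)).trans (mul_le_mul_of_nonneg_left ?_ hC0)
      exact Real.rpow_le_rpow_of_nonpos hL0 (by exact_mod_cast hn) (by linarith)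
    refine (measureReal_hasRelationAt_le hp hξ_indep hξ_one g m k hD).trans ?_
    have hS := sum_Ico_le_of_le_rpow hC0 hε0 hC hL
    have hS0 : 0 ≤ ∑ n ∈ Finset.Ico 1 L, p n :=
      Finset.sum_nonneg fun n hn => (hp n (Finset.mem_Ico.1 hn).1).le
    calc (2 * (m : ℝ) + 1) ^ (k + 2) * ((C * (L : ℝ) ^ (-(1 - ε))) ^ 2 *
          (∑ n ∈ Finset.Ico 1 L, p n) ^ k)
        ≤ (2 * (m : ℝ) + 1) ^ (k + 2) * ((C * (L : ℝ) ^ (-(1 - ε))) ^ 2 *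
          (C * (1 + 1 / ε) * (L : ℝ) ^ (2 * ε)) ^ k) := by gcongr
      _ = K * (((L : ℝ) ^ (-(1 - ε))) ^ 2 * ((L : ℝ) ^ (2 * ε)) ^ k) := by
        rw [hK]
        generalize C * (1 + 1 / ε) = E
        rw [mul_pow C, mul_pow E]
        ring
      _ = K * (L : ℝ) ^ (-(3 / 2) : ℝ) := by
        rw [← Real.rpow_mul_natCast hL0.le, ← Real.rpow_mul_natCast hL0.le, ← Real.rpow_add hL0]
        congr 2
        push_cast
        linarith
  have hsum : Summable fun L : ℕ => K * (L : ℝ) ^ (-(3 / 2) : ℝ) :=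
    (Real.summable_nat_rpow.2 (by norm_num)).mul_left K
  have hBC : ∑' L : ℕ, P {ω | HasRelationAt (randomSet ξ ω) g m k (L + 1)} ≠ ⊤ := by
    have hsum' := (summable_nat_add_iff 1).2 hsum
    refine ne_top_of_le_ne_top hsum'.tsum_ofReal_ne_top (ENNReal.tsum_le_tsum fun L => ?_)
    rw [← ofReal_measureReal]
    exact ENNReal.ofReal_le_ofReal (hle (L + 1) (by omega))
  filter_upwards [ae_eventually_notMem hBC] with ω hω
  rw [← map_add_atTop_eq_nat 1]
  exact eventually_map.2 hω

/-! ### Large deviations of random exponential sums -/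

theorem ae_eq_zero_or_one {Ω : Type u} [MeasurableSpace Ω] {P : Measure Ω}
    [IsProbabilityMeasure P] {X : Ω → ℝ} {q : ℝ} (hX : Measurable X)
    (h1 : P.real {ω | X ω = 1} = q) (h0 : P.real {ω | X ω = 0} = 1 - q) :
    ∀ᵐ ω ∂P, X ω = 0 ∨ X ω = 1 := by
  have hm1 : MeasurableSet {ω | X ω = 1} := hX (measurableSet_singleton 1)
  have hm0 : MeasurableSet {ω | X ω = 0} := hX (measurableSet_singleton 0)
  have hdisj : Disjoint {ω | X ω = 0} {ω | X ω = 1} := by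
    rw [Set.disjoint_left]
    intro ω h h'
    simp only [Set.mem_ofPred_eq] at h h'
    linarith
  have h := measureReal_union (μ := P) hdisj hm1
  rw [h1, h0, sub_add_cancel] at h
  have hc : P.real ({ω | X ω = 0} ∪ {ω | X ω = 1})ᶜ = 0 := by
    rw [probReal_compl_eq_one_sub (hm0.union hm1), h, sub_self]
  rw [measureReal_eq_zero_iff] at hc
  exact measure_eq_zero_iff_ae_notMem.1 hc |>.mono fun ω hω => by
    simpa [or_iff_not_imp_left] using hω

theorem mgf_eq_of_ae_eq_zero_or_one {Ω : Type u} [MeasurableSpace Ω] {P : Measure Ω}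
    [IsProbabilityMeasure P] {X : Ω → ℝ} {q : ℝ} (hX : Measurable X)
    (h1 : P.real {ω | X ω = 1} = q) (h01 : ∀ᵐ ω ∂P, X ω = 0 ∨ X ω = 1) (s : ℝ) :
    mgf X P s = 1 + q * (Real.exp s - 1) := by
  have hm1 : MeasurableSet {ω | X ω = 1} := hX (measurableSet_singleton 1)
  have hae : (fun ω => Real.exp (s * X ω)) =ᵐ[P]
      fun ω => 1 + {ω | X ω = 1}.indicator (fun _ => Real.exp s - 1) ω := by
    filter_upwards [h01] with ω hω
    rcases hω with h | h <;> simp [h, Set.indicator]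
  rw [mgf, integral_congr_ae hae, integral_add (integrable_const _)
    ((integrable_const _).indicator hm1), integral_indicator_const _ hm1, h1]
  simp

/-- A Bernstein type inequality for weighted sums of centred independent Bernoulli variables. -/
theorem measureReal_le_sum_mul_sub_le {Ω : Type u} [MeasurableSpace Ω] {P : Measure Ω}
    [IsProbabilityMeasure P] {X : ℕ → Ω → ℝ} {q : ℕ → ℝ} (hX : ∀ i, Measurable (X i))
    (hq : ∀ i, 0 ≤ q i) (hindep : iIndepFun X P) (h1 : ∀ i, P.real {ω | X i ω = 1} = q i)
    (h01 : ∀ i, ∀ᵐ ω ∂P, X i ω = 0 ∨ X i ω = 1) {b : ℕ → ℝ} (hb : ∀ i, |b i| ≤ 1)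
    {ε : ℝ} (hε : 0 < ε) (hε1 : ε ≤ 1) (N : ℕ) :
    P.real {ω | ε * ∑ i ∈ Finset.range N, q i ≤ ∑ i ∈ Finset.range N, b i * (X i ω - q i)} ≤
      Real.exp (-(ε ^ 2 / 4 * ∑ i ∈ Finset.range N, q i)) := by
  set S := ∑ i ∈ Finset.range N, q i with hS
  set Y : ℕ → Ω → ℝ := fun i ω => b i * (X i ω - q i) with hY
  have hYm : ∀ i, Measurable (Y i) := fun i => ((hX i).sub_const _).const_mul _
  have hYi : iIndepFun Y P :=
    hindep.comp (fun i x => b i * (x - q i)) fun i => by fun_prop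
  -- this value of `t` minimizes the exponent `-t ε S + t² S` of the Chernoff bound
  set t : ℝ := ε / 2 with ht
  have ht0 : 0 < t := by positivity
  have hmgf : ∀ i, mgf (Y i) P t ≤ Real.exp (t ^ 2 * q i) := by
    intro i
    have h2 : mgf (Y i) P t =
        Real.exp (-(t * b i * q i)) * (1 + q i * (Real.exp (t * b i) - 1)) := by
      rw [← mgf_eq_of_ae_eq_zero_or_one (hX i) (h1 i) (h01 i), mgf, mgf, ← integral_const_mul]
      refine integral_congr_ae (ae_of_all _ fun ω => ?_)
      simp only [hY, ← Real.exp_add]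
      congr 1
      ring
    have habs : |t * b i| ≤ 1 := by
      rw [abs_mul, abs_of_pos ht0]
      have := mul_le_mul_of_nonneg_left (hb i) ht0.le
      linarith
    have h3 : Real.exp (t * b i) - 1 - t * b i ≤ t ^ 2 := by
      refine (le_abs_self _).trans ((Real.abs_exp_sub_one_sub_id_le habs).trans ?_)
      rw [mul_pow]
      exact mul_le_of_le_one_right (by positivity) ((sq_le_one_iff_abs_le_one _).2 (hb i))
    rw [h2]
    calc _ ≤ Real.exp (-(t * b i * q i)) * Real.exp (q i * (Real.exp (t * b i) - 1)) := by
          gcongr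
          rw [add_comm]
          exact Real.add_one_le_exp _
      _ = Real.exp (q i * (Real.exp (t * b i) - 1 - t * b i)) := by
          rw [← Real.exp_add]
          congr 1
          ring
      _ ≤ Real.exp (t ^ 2 * q i) := by
          rw [Real.exp_le_exp, mul_comm (t ^ 2)]
          exact mul_le_mul_of_nonneg_left h3 (hq i)
  have hint : ∀ i ∈ Finset.range N, Integrable (fun ω => Real.exp (t * Y i ω)) P := by
    intro i _
    refine integrable_exp_mul_of_mem_Icc (a := -(1 + q i)) (b := 1 + q i)
      (hYm i).aemeasurable ?_
    filter_upwards [h01 i] with ω hω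
    have : |Y i ω| ≤ 1 + q i := by
      simp only [hY]
      rw [abs_mul]
      refine (mul_le_of_le_one_left (abs_nonneg _) (hb i)).trans ?_
      have := hq i
      rcases hω with h | h <;> rw [h, abs_le] <;> constructor <;> linarith
    exact abs_le.1 this
  have hch := measure_ge_le_exp_mul_mgf (μ := P) (X := ∑ i ∈ Finset.range N, Y i) (ε * S) ht0.le
    (hYi.integrable_exp_mul_sum hYm hint)
  rw [hYi.mgf_sum hYm] at hch
  have hprod : ∏ i ∈ Finset.range N, mgf (Y i) P t ≤ Real.exp (t ^ 2 * S) := by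
    rw [hS, Finset.mul_sum, Real.exp_sum]
    exact Finset.prod_le_prod (fun i _ => mgf_nonneg) fun i _ => hmgf i
  simp only [Finset.sum_apply] at hch
  refine hch.trans ((mul_le_mul_of_nonneg_left hprod (Real.exp_pos _).le).trans ?_)
  rw [← Real.exp_add, Real.exp_le_exp, ht]
  apply le_of_eq
  ring

theorem measureReal_le_norm_sum_pow_le {Ω : Type u} [MeasurableSpace Ω] {P : Measure Ω}
    [IsProbabilityMeasure P] {X : ℕ → Ω → ℝ} {q : ℕ → ℝ} (hX : ∀ i, Measurable (X i))
    (hq : ∀ i, 0 ≤ q i) (hindep : iIndepFun X P) (h1 : ∀ i, P.real {ω | X i ω = 1} = q i)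
    (h01 : ∀ i, ∀ᵐ ω ∂P, X i ω = 0 ∨ X i ω = 1) {z : ℂ} (hz : ‖z‖ = 1)
    {ε : ℝ} (hε : 0 < ε) (hε1 : ε ≤ 1) (N : ℕ) :
    P.real {ω | 2 * ε * ∑ i ∈ Finset.range N, q i ≤
        ‖∑ i ∈ Finset.range N, ((X i ω - q i : ℝ) : ℂ) * z ^ (i + 1)‖} ≤
      4 * Real.exp (-(ε ^ 2 / 4 * ∑ i ∈ Finset.range N, q i)) := by
  set S := ∑ i ∈ Finset.range N, q i with hS
  have hre : ∀ i, |(z ^ (i + 1)).re| ≤ 1 := fun i =>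
    (Complex.abs_re_le_norm _).trans (by simp [hz])
  have him : ∀ i, |(z ^ (i + 1)).im| ≤ 1 := fun i =>
    (Complex.abs_im_le_norm _).trans (by simp [hz])
  set E : (ℕ → ℝ) → Set Ω := fun b => {ω | ε * S ≤ ∑ i ∈ Finset.range N, b i * (X i ω - q i)}
    with hE
  have hEle : ∀ b : ℕ → ℝ, (∀ i, |b i| ≤ 1) → P.real (E b) ≤ Real.exp (-(ε ^ 2 / 4 * S)) :=
    fun b hb => measureReal_le_sum_mul_sub_le hX hq hindep h1 h01 hb hε hε1 N
  have hsub : {ω | 2 * ε * S ≤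
        ‖∑ i ∈ Finset.range N, ((X i ω - q i : ℝ) : ℂ) * z ^ (i + 1)‖} ⊆
      (E (fun i => (z ^ (i + 1)).re) ∪ E (fun i => -(z ^ (i + 1)).re)) ∪
      (E (fun i => (z ^ (i + 1)).im) ∪ E (fun i => -(z ^ (i + 1)).im)) := by
    intro ω hω
    simp only [Set.mem_ofPred_eq] at hω
    have h2 := hω.trans (Complex.norm_le_abs_re_add_abs_im _)
    simp only [Complex.re_sum, Complex.im_sum, Complex.re_ofReal_mul, Complex.im_ofReal_mul,
      mul_comm (_ - _)] at h2
    simp only [hE, Set.mem_union, Set.mem_ofPred_eq, neg_mul, Finset.sum_neg_distrib, ← le_abs]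
    by_contra! hcon
    linarith [hcon.1, hcon.2]
  refine (measureReal_mono hsub).trans ((measureReal_union_le _ _).trans ?_)
  have a1 := measureReal_union_le (μ := P) (E (fun i => (z ^ (i + 1)).re))
    (E (fun i => -(z ^ (i + 1)).re))
  have a2 := measureReal_union_le (μ := P) (E (fun i => (z ^ (i + 1)).im))
    (E (fun i => -(z ^ (i + 1)).im))
  have b1 := hEle _ hre
  have b2 := hEle (fun i => -(z ^ (i + 1)).re) fun i => by rw [abs_neg]; exact hre i
  have b3 := hEle _ him
  have b4 := hEle (fun i => -(z ^ (i + 1)).im) fun i => by rw [abs_neg]; exact him i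
  linarith

theorem norm_pow_sub_pow_le {z z' : ℂ} (hz : ‖z‖ = 1) (hz' : ‖z'‖ = 1) (n : ℕ) :
    ‖z ^ n - z' ^ n‖ ≤ n * ‖z - z'‖ := by
  induction n with
  | zero => simp
  | succ n ih =>
    have : z ^ (n + 1) - z' ^ (n + 1) = z ^ n * (z - z') + (z ^ n - z' ^ n) * z' := by ring
    rw [this]
    refine (norm_add_le _ _).trans ?_
    rw [norm_mul, norm_mul, norm_pow, hz, hz', one_pow, one_mul, mul_one]
    push_cast
    linarith

/-- Every point of the unit circle is within `2π / M` of an `M`-th root of unity. -/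
theorem exists_norm_sub_exp_le {M : ℕ} (hM : 0 < M) {z : ℂ} (hz : ‖z‖ = 1) :
    ∃ j < M, ‖z - Complex.exp ((2 * Real.pi * j / M : ℝ) * Complex.I)‖ ≤ 2 * Real.pi / M := by
  have hM0 : (0 : ℝ) < M := by exact_mod_cast hM
  have h2pi : 0 < 2 * Real.pi := Real.two_pi_pos
  obtain ⟨θ, hθ0, hθ1, hzθ⟩ : ∃ θ : ℝ, 0 ≤ θ ∧ θ < 2 * Real.pi ∧
      z = Complex.exp (θ * Complex.I) := by
    refine ⟨toIcoMod h2pi 0 z.arg, ?_, ?_, ?_⟩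
    · exact (toIcoMod_mem_Ico h2pi 0 _).1
    · simpa using (toIcoMod_mem_Ico h2pi 0 z.arg).2
    · have h := Complex.norm_mul_exp_arg_mul_I z
      rw [hz, Complex.ofReal_one, one_mul] at h
      conv_lhs => rw [← h]
      rw [toIcoMod, Complex.exp_eq_exp_iff_exists_int]
      refine ⟨toIcoDiv h2pi 0 z.arg, ?_⟩
      simp only [zsmul_eq_mul]
      push_cast
      ring
  set j := ⌊θ * M / (2 * Real.pi)⌋₊ with hj
  have hnn : 0 ≤ θ * M / (2 * Real.pi) := by positivity
  have hj1 : (j : ℝ) ≤ θ * M / (2 * Real.pi) := Nat.floor_le hnn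
  have hj2 : θ * M / (2 * Real.pi) < j + 1 := Nat.lt_floor_add_one _
  rw [le_div_iff₀ h2pi] at hj1
  rw [div_lt_iff₀ h2pi] at hj2
  refine ⟨j, ?_, ?_⟩
  · rw [Nat.floor_lt hnn, div_lt_iff₀ h2pi, mul_comm (M : ℝ)]
    gcongr
  · set φ : ℝ := 2 * Real.pi * j / M with hφ
    have hd : |θ - φ| ≤ 2 * Real.pi / M := by
      have : θ - φ = (θ * M - j * (2 * Real.pi)) / M := by
        rw [hφ]
        field_simp
      rw [this, abs_div, abs_of_pos hM0]
      gcongr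
      rw [abs_le]
      constructor <;> linarith
    rw [hzθ]
    have : Complex.exp (θ * Complex.I) - Complex.exp (φ * Complex.I) =
        Complex.exp (φ * Complex.I) * (Complex.exp (Complex.I * (θ - φ : ℝ)) - 1) := by
      rw [mul_sub, ← Complex.exp_add, mul_one]
      congr 2
      push_cast
      ring
    rw [this, norm_mul, Complex.norm_exp_ofReal_mul_I, one_mul]
    exact (Real.norm_exp_I_mul_ofReal_sub_one_le).trans (by simpa using hd)

/-! ### Uniform estimates for random exponential sums -/

/-- Passing from `z` to a nearby `N ^ 3`-th root of unity changes each of the `N` terms by at most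
`2π / N ^ 2`, hence the sum by at most `2π / N < 7`. -/
theorem norm_sum_mul_pow_le_add {N : ℕ} (hN : 0 < N) {y : ℕ → ℝ} (hy : ∀ i, |y i| ≤ 1)
    {z z' : ℂ} (hz : ‖z‖ = 1) (hz' : ‖z'‖ = 1) (hzz' : ‖z - z'‖ ≤ 2 * Real.pi / (N ^ 3 : ℕ)) :
    ‖∑ i ∈ Finset.range N, (y i : ℂ) * z ^ (i + 1)‖ ≤
      ‖∑ i ∈ Finset.range N, (y i : ℂ) * z' ^ (i + 1)‖ + 7 := by
  have hN1 : (1 : ℝ) ≤ N := by exact_mod_cast hN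
  have hdiff : ‖∑ i ∈ Finset.range N, (y i : ℂ) * z ^ (i + 1) -
      ∑ i ∈ Finset.range N, (y i : ℂ) * z' ^ (i + 1)‖ ≤ 7 := by
    rw [← Finset.sum_sub_distrib]
    have hterm : ∀ i ∈ Finset.range N, ‖(y i : ℂ) * z ^ (i + 1) - (y i : ℂ) * z' ^ (i + 1)‖ ≤
        N * (2 * Real.pi / (N ^ 3 : ℕ)) := by
      intro i hi
      rw [Finset.mem_range] at hi
      rw [← mul_sub, norm_mul, Complex.norm_real, Real.norm_eq_abs]
      refine (mul_le_of_le_one_left (norm_nonneg _) (hy i)).trans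
        ((norm_pow_sub_pow_le hz hz' _).trans ?_)
      gcongr
      omega
    refine (norm_sum_le_of_le _ hterm).trans ?_
    rw [Finset.sum_const, Finset.card_range, nsmul_eq_mul]
    have : (N : ℝ) * (N * (2 * Real.pi / (N ^ 3 : ℕ))) = 2 * Real.pi / N := by
      push_cast
      field_simp
    rw [this, div_le_iff₀ (by positivity)]
    nlinarith [Real.pi_lt_d2]
  have := norm_le_norm_add_norm_sub' (∑ i ∈ Finset.range N, (y i : ℂ) * z ^ (i + 1))
    (∑ i ∈ Finset.range N, (y i : ℂ) * z' ^ (i + 1))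
  linarith

theorem eventually_mul_log_le {S : ℕ → ℝ}
    (h : Tendsto (fun N : ℕ => 1 / Real.log N * S N) atTop atTop) (C : ℝ) :
    ∀ᶠ N : ℕ in atTop, C * Real.log N ≤ S N := by
  filter_upwards [h.eventually_ge_atTop C, eventually_gt_atTop 1] with N hN hN1
  have hpos : 0 < Real.log N := Real.log_pos (by exact_mod_cast hN1)
  rwa [one_div, inv_mul_eq_div, le_div_iff₀ hpos] at hN

theorem tendsto_atTop_of_one_div_log_mul {S : ℕ → ℝ}
    (h : Tendsto (fun N : ℕ => 1 / Real.log N * S N) atTop atTop) : Tendsto S atTop atTop := by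
  refine tendsto_atTop_mono' _ ?_ (Real.tendsto_log_atTop.comp tendsto_natCast_atTop_atTop)
  simpa only [one_mul] using! eventually_mul_log_le h 1

/-- Almost surely, the random exponential sums are uniformly close to their expectations. For a
single `z` the exceptional probability is `O(N ^ (-5))`, because `∑ q` grows faster than `log N`,
and the `N ^ 3`-th roots of unity are dense enough to control all `z`. -/
theorem ae_eventually_norm_sum_pow_le {Ω : Type u} [MeasurableSpace Ω] {P : Measure Ω}
    [IsProbabilityMeasure P] {X : ℕ → Ω → ℝ} {q : ℕ → ℝ} (hX : ∀ i, Measurable (X i))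
    (hq : ∀ i, 0 ≤ q i) (hq1 : ∀ i, q i ≤ 1) (hindep : iIndepFun X P)
    (h1 : ∀ i, P.real {ω | X i ω = 1} = q i)
    (h01 : ∀ i, ∀ᵐ ω ∂P, X i ω = 0 ∨ X i ω = 1)
    (hlog : Tendsto (fun N : ℕ => 1 / Real.log N * ∑ i ∈ Finset.range N, q i) atTop atTop) :
    ∀ᵐ ω ∂P, ∀ ε : ℝ, 0 < ε → ∀ᶠ N : ℕ in atTop, ∀ z : ℂ, ‖z‖ = 1 →
      ‖∑ i ∈ Finset.range N, ((X i ω - q i : ℝ) : ℂ) * z ^ (i + 1)‖ ≤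
        ε * ∑ i ∈ Finset.range N, q i := by
  set S : ℕ → ℝ := fun N => ∑ i ∈ Finset.range N, q i with hS
  have hStop : Tendsto S atTop atTop := tendsto_atTop_of_one_div_log_mul hlog
  have hgrid : ∀ r : ℕ, ∀ᵐ ω ∂P, ∀ᶠ N : ℕ in atTop, ∀ z : ℂ, ‖z‖ = 1 →
      ‖∑ i ∈ Finset.range N, ((X i ω - q i : ℝ) : ℂ) * z ^ (i + 1)‖ ≤
        2 * (1 / (r + 1 : ℝ)) * S N + 7 := by
    intro r
    set ε : ℝ := 1 / (r + 1 : ℝ) with hε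
    have hε0 : 0 < ε := by positivity
    have hε1 : ε ≤ 1 := by
      rw [hε, div_le_one (by positivity)]
      simp
    set ζ : ℕ → ℕ → ℂ := fun N j => Complex.exp ((2 * Real.pi * j / (N ^ 3 : ℕ) : ℝ) * Complex.I)
      with hζ
    have hζ1 : ∀ N j, ‖ζ N j‖ = 1 := fun N j => Complex.norm_exp_ofReal_mul_I _
    set Bad : ℕ → Set Ω := fun N => ⋃ j ∈ Finset.range (N ^ 3),
      {ω | 2 * ε * S N ≤ ‖∑ i ∈ Finset.range N, ((X i ω - q i : ℝ) : ℂ) * ζ N j ^ (i + 1)‖}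
      with hBad
    have hBadle : ∀ᶠ N : ℕ in atTop, P.real (Bad N) ≤ 4 * (N : ℝ) ^ (-2 : ℝ) := by
      filter_upwards [eventually_mul_log_le hlog (20 / ε ^ 2), eventually_gt_atTop 0] with N hN hN0
      have hN0' : (0 : ℝ) < N := by exact_mod_cast hN0
      refine (measureReal_biUnion_finset_le _ _).trans ?_
      refine (Finset.sum_le_sum fun j _ => measureReal_le_norm_sum_pow_le hX hq hindep h1 h01
        (hζ1 N j) hε0 hε1 N).trans ?_
      rw [Finset.sum_const, Finset.card_range, nsmul_eq_mul]
      have hexp : Real.exp (-(ε ^ 2 / 4 * S N)) ≤ (N : ℝ) ^ (-5 : ℝ) := by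
        rw [Real.rpow_def_of_pos hN0', Real.exp_le_exp]
        have h5 : ε ^ 2 / 4 * (20 / ε ^ 2 * Real.log N) = 5 * Real.log N := by
          field_simp
          ring
        have := mul_le_mul_of_nonneg_left hN (show 0 ≤ ε ^ 2 / 4 by positivity)
        linarith
      calc _ ≤ ((N ^ 3 : ℕ) : ℝ) * (4 * (N : ℝ) ^ (-5 : ℝ)) := by gcongr
        _ = 4 * ((N : ℝ) ^ (3 : ℝ) * (N : ℝ) ^ (-5 : ℝ)) := by
          push_cast
          rw [show ((N : ℝ) ^ (3 : ℝ)) = (N : ℝ) ^ 3 by exact_mod_cast Real.rpow_natCast (N : ℝ) 3]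
          ring
        _ = 4 * (N : ℝ) ^ (-2 : ℝ) := by
          rw [← Real.rpow_add hN0']
          norm_num
    obtain ⟨N₀, hN₀⟩ := eventually_atTop.1 hBadle
    have hsum : Summable fun N : ℕ => 4 * (N : ℝ) ^ (-2 : ℝ) :=
      (Real.summable_nat_rpow.2 (by norm_num)).mul_left 4
    have hBC : ∑' N : ℕ, P (Bad (N + N₀)) ≠ ⊤ := by
      have hsum' := (summable_nat_add_iff N₀).2 hsum
      refine ne_top_of_le_ne_top hsum'.tsum_ofReal_ne_top (ENNReal.tsum_le_tsum fun N => ?_)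
      rw [← ofReal_measureReal (measure_ne_top _ _)]
      exact ENNReal.ofReal_le_ofReal (hN₀ (N + N₀) (by omega))
    filter_upwards [ae_eventually_notMem hBC, ae_all_iff.2 h01] with ω hω hω01
    have hω' : ∀ᶠ N in atTop, ω ∉ Bad N := by
      rw [← map_add_atTop_eq_nat N₀]
      exact eventually_map.2 hω
    filter_upwards [hω', eventually_gt_atTop 0] with N hN hN0 z hz
    obtain ⟨j, hj, hjz⟩ := exists_norm_sub_exp_le (M := N ^ 3) (by positivity) hz
    have hy : ∀ i, |X i ω - q i| ≤ 1 := by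
      intro i
      have := hq i
      have := hq1 i
      rcases hω01 i with h | h <;> rw [h, abs_le] <;> constructor <;> linarith
    refine (norm_sum_mul_pow_le_add hN0 hy hz (hζ1 N j) hjz).trans ?_
    have hlt : ¬ 2 * ε * S N ≤
        ‖∑ i ∈ Finset.range N, ((X i ω - q i : ℝ) : ℂ) * ζ N j ^ (i + 1)‖ := fun h =>
      hN (Set.mem_iUnion₂.2 ⟨j, Finset.mem_range.2 hj, h⟩)
    linarith [not_le.1 hlt]
  filter_upwards [ae_all_iff.2 hgrid] with ω hω ε hε
  -- `2 / (r + 1) ≤ ε / 2`, and `7 ≤ ε / 2 * S N` once `S N ≥ 14 / ε`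
  obtain ⟨r, hr⟩ := exists_nat_one_div_lt (show 0 < ε / 4 by positivity)
  filter_upwards [hω r, hStop.eventually_ge_atTop (14 / ε)] with N hN hSN z hz
  refine (hN z hz).trans ?_
  rw [div_le_iff₀ hε] at hSN
  have hSN0 : 0 ≤ S N := Finset.sum_nonneg fun i _ => hq i
  have := mul_le_mul_of_nonneg_right hr.le hSN0
  linarith

/-- Summation by parts. -/
theorem norm_sub_one_mul_sum_pow_le {q : ℕ → ℝ} (hq : ∀ i, 0 ≤ q i) (hq1 : ∀ i, q i ≤ 1)
    {z : ℂ} (hz : ‖z‖ = 1) (N : ℕ) :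
    ‖(z - 1) * ∑ i ∈ Finset.range N, (q i : ℂ) * z ^ (i + 1)‖ ≤
      2 + ∑ i ∈ Finset.range N, |q (i + 1) - q i| := by
  have hid : (z - 1) * ∑ i ∈ Finset.range N, (q i : ℂ) * z ^ (i + 1) =
      q N * z ^ (N + 1) - q 0 * z -
        ∑ i ∈ Finset.range N, ((q (i + 1) - q i : ℝ) : ℂ) * z ^ (i + 2) := by
    induction N with
    | zero => simp
    | succ N ih =>
      rw [Finset.sum_range_succ, mul_add, ih, Finset.sum_range_succ]
      push_cast
      ring
  have hle : ∀ i, |q i| ≤ 1 := fun i => by rw [abs_of_nonneg (hq i)]; exact hq1 i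
  rw [hid]
  refine (norm_sub_le _ _).trans (add_le_add ((norm_sub_le _ _).trans ?_)
    (norm_sum_le_of_le _ fun i _ => ?_))
  · rw [norm_mul, norm_mul, norm_pow, hz, one_pow, mul_one, mul_one, Complex.norm_real,
      Complex.norm_real, Real.norm_eq_abs, Real.norm_eq_abs]
    linarith [hle N, hle 0]
  · rw [norm_mul, norm_pow, hz, one_pow, mul_one, Complex.norm_real, Real.norm_eq_abs]

/-- The deterministic conclusion: `x i` is the indicator of `i + 1 ∈ A` and `q i` its expectation.
The point `z = 1` of `hdev` shows that `A` has about `∑_{i < N} q i` elements up to `N`; for the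
other `z`, `(z - 1) ∑ q i z ^ (i + 1)` is negligible by summation by parts. -/
theorem infinite_and_isUniformlyErgodic_nth {A : Set ℕ} (hA : ∀ n ∈ A, 1 ≤ n) {x q : ℕ → ℝ}
    (hx1 : ∀ i, i + 1 ∈ A → x i = 1) (hx0 : ∀ i, i + 1 ∉ A → x i = 0)
    (hq : ∀ i, 0 ≤ q i) (hq1 : ∀ i, q i ≤ 1)
    (hS : Tendsto (fun N => ∑ i ∈ Finset.range N, q i) atTop atTop)
    (hvar : (fun N : ℕ => ∑ i ∈ Finset.range N, |q (i + 1) - q i|) =o[atTop]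
      fun N : ℕ => ∑ i ∈ Finset.range N, q i)
    (hdev : ∀ ε : ℝ, 0 < ε → ∀ᶠ N : ℕ in atTop, ∀ z : ℂ, ‖z‖ = 1 →
      ‖∑ i ∈ Finset.range N, ((x i - q i : ℝ) : ℂ) * z ^ (i + 1)‖ ≤
        ε * ∑ i ∈ Finset.range N, q i) :
    A.Infinite ∧ IsUniformlyErgodic (Nat.nth (· ∈ A)) := by
  classical
  set S : ℕ → ℝ := fun N => ∑ i ∈ Finset.range N, q i with hSdef
  have hS0 : ∀ N, 0 ≤ S N := fun N => Finset.sum_nonneg fun i _ => hq i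
  have hcount : ∀ᶠ N : ℕ in atTop, S N ≤ 2 * ∑ i ∈ Finset.range N, x i := by
    filter_upwards [hdev (1 / 2) (by norm_num)] with N hN
    have h := hN 1 (by simp)
    simp only [one_pow, mul_one] at h
    rw [← Complex.ofReal_sum, Complex.norm_real, Real.norm_eq_abs, Finset.sum_sub_distrib] at h
    have := (abs_le.1 h).1
    linarith
  have h0A : 0 ∉ A := fun h => by simpa using hA 0 h
  have hsum : ∀ (N : ℕ) (φ : ℕ → ℂ), ∑ i ∈ Finset.range N, (x i : ℂ) * φ (i + 1) =
      ∑ k ∈ Finset.range (Nat.count (· ∈ A) (N + 1)), φ (Nat.nth (· ∈ A) k) := by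
    intro N φ
    induction N with
    | zero => simp [Nat.count_succ, h0A]
    | succ N ih =>
      rw [Finset.sum_range_succ, ih, Nat.count_succ _ (N + 1)]
      by_cases h : N + 1 ∈ A
      · rw [if_pos h, Finset.sum_range_succ, Nat.nth_count (p := (· ∈ A)) h, hx1 N h]
        simp
      · rw [if_neg h, hx0 N h]
        simp
  have hsumx : ∀ N : ℕ, ∑ i ∈ Finset.range N, x i = Nat.count (· ∈ A) (N + 1) := by
    intro N
    have := hsum N fun _ => 1
    simp only [mul_one, Finset.sum_const, Finset.card_range, nsmul_eq_mul] at this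
    exact_mod_cast this
  have hinf : A.Infinite := by
    intro hfin
    obtain ⟨N, hN1, hN2⟩ := (hcount.and (hS.eventually_gt_atTop (2 * hfin.toFinset.card))).exists
    have h := Nat.count_le_card (p := (· ∈ A)) hfin (N + 1)
    have h' : (Nat.count (· ∈ A) (N + 1) : ℝ) ≤ hfin.toFinset.card := by exact_mod_cast h
    rw [hsumx] at hN1
    linarith
  refine ⟨hinf, fun ε hε => ?_⟩
  have hev : ∀ᶠ N : ℕ in atTop, ∀ z : ℂ, ‖z‖ = 1 →
      ‖(z - 1) * ∑ i ∈ Finset.range N, (x i : ℂ) * z ^ (i + 1)‖ ≤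
        ε * ∑ i ∈ Finset.range N, x i := by
    filter_upwards [hcount, hdev (ε / 12) (by positivity),
      hvar.bound (show 0 < ε / 6 by positivity), hS.eventually_ge_atTop (12 / ε)]
      with N h1 h2 h3 h4 z hz
    -- the threshold `12 / ε` absorbs the boundary terms of the summation by parts
    have hsplit : (z - 1) * ∑ i ∈ Finset.range N, (x i : ℂ) * z ^ (i + 1) =
        (z - 1) * ∑ i ∈ Finset.range N, ((x i - q i : ℝ) : ℂ) * z ^ (i + 1) +
        (z - 1) * ∑ i ∈ Finset.range N, (q i : ℂ) * z ^ (i + 1) := by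
      rw [← mul_add, ← Finset.sum_add_distrib]
      congr 1
      refine Finset.sum_congr rfl fun i _ => ?_
      push_cast
      ring
    have hz2 : ‖z - 1‖ ≤ 2 := (norm_sub_le _ _).trans (by rw [hz, norm_one]; norm_num)
    have h5 := norm_sub_one_mul_sum_pow_le hq hq1 hz N
    have h6 : ‖(z - 1) * ∑ i ∈ Finset.range N, ((x i - q i : ℝ) : ℂ) * z ^ (i + 1)‖ ≤
        2 * (ε / 12 * S N) := by
      rw [norm_mul]
      exact mul_le_mul hz2 (h2 z hz) (norm_nonneg _) (by norm_num)
    rw [Real.norm_eq_abs, Real.norm_eq_abs, abs_of_nonneg (hS0 N),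
      abs_of_nonneg (Finset.sum_nonneg fun i _ => abs_nonneg _)] at h3
    rw [div_le_iff₀ hε] at h4
    rw [hsplit]
    refine (norm_add_le _ _).trans ?_
    have h7 := mul_le_mul_of_nonneg_left h1 hε.le
    linarith
  -- stopping just before `n_K`, the partial sum has exactly the terms `n_0, …, n_{K - 1}`
  have hnth : Tendsto (fun K => Nat.nth (· ∈ A) K - 1) atTop atTop :=
    (tendsto_sub_atTop_nat 1).comp (Nat.nth_strictMono hinf).tendsto_atTop
  filter_upwards [hnth.eventually hev] with K hK z hz
  have hpos : Nat.nth (· ∈ A) K - 1 + 1 = Nat.nth (· ∈ A) K :=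
    Nat.sub_add_cancel (hA _ (Nat.nth_mem_of_infinite hinf K))
  have h := hK z hz
  rwa [hsumx, hsum _ fun n => z ^ n, hpos, Nat.count_nth_of_infinite (p := (· ∈ A)) hinf] at h

/-! ### Properties of the random sequence -/

theorem sum_Icc_one_eq_sum_range (f : ℕ → ℝ) (N : ℕ) :
    ∑ n ∈ Finset.Icc 1 N, f n = ∑ i ∈ Finset.range N, f (i + 1) := by
  rw [Finset.range_eq_Ico, Finset.sum_Ico_add' f 0 N 1]
  rfl

theorem mainTheorem5 {Ω : Type u} [MeasurableSpace Ω] (P : Measure Ω) [IsProbabilityMeasure P]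
    (p : ℕ → ℝ) (hp : ∀ n : ℕ, 1 ≤ n → 0 < p n ∧ p n < 1)
    (ξ : ℕ → Ω → ℝ) (hξ_meas : ∀ n : ℕ, 1 ≤ n → Measurable (ξ n))
    (hξ_indep : iIndepFun (fun n : ℕ => ξ (n + 1)) P)
    (hξ_one : ∀ n : ℕ, 1 ≤ n → P.real {ω | ξ n ω = 1} = p n)
    (hξ_zero : ∀ n : ℕ, 1 ≤ n → P.real {ω | ξ n ω = 0} = 1 - p n)
    (h1 : Tendsto (fun N : ℕ => 1 / Real.log N * ∑ n ∈ Finset.Icc 1 N, p n) atTop atTop)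
    (h2 : (fun N : ℕ => ∑ n ∈ Finset.Icc 1 N, |p (n + 1) - p n|)
      =o[atTop] fun N : ℕ => ∑ n ∈ Finset.Icc 1 N, p n)
    (h3 : ∀ ε : ℝ, 0 < ε → ε < 1 → p =O[atTop] fun n : ℕ => 1 / (n : ℝ) ^ (1 - ε)) :
    ∀ᵐ ω ∂P,
      (randomSet ξ ω).Infinite ∧
      IsNullpotent (fun k => (randomSeq ξ ω k : ℤ)) ∧
      IsKazhdanSet.{v} (Set.range fun k => (randomSeq ξ ω k : ℤ)) ∧
      ¬ IsRigiditySequence.{w} (randomSeq ξ ω) ∧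
      ∀ a : ℤ, IsSetOfRecurrence.{w}
        ((fun x : ℤ => x + a) '' Set.range fun k => (randomSeq ξ ω k : ℤ)) := by
  set X : ℕ → Ω → ℝ := fun i => ξ (i + 1) with hX
  set q : ℕ → ℝ := fun i => p (i + 1) with hq
  have hq0 : ∀ i, 0 ≤ q i := fun i => (hp (i + 1) (by omega)).1.le
  have hq1 : ∀ i, q i ≤ 1 := fun i => (hp (i + 1) (by omega)).2.le
  have hXm : ∀ i, Measurable (X i) := fun i => hξ_meas (i + 1) (by omega)
  have hX1 : ∀ i, P.real {ω | X i ω = 1} = q i := fun i => hξ_one (i + 1) (by omega)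
  have hX01 : ∀ i, ∀ᵐ ω ∂P, X i ω = 0 ∨ X i ω = 1 := fun i =>
    ae_eq_zero_or_one (hXm i) (hX1 i) (hξ_zero (i + 1) (by omega))
  simp only [sum_Icc_one_eq_sum_range] at h1 h2
  have hS : Tendsto (fun N => ∑ i ∈ Finset.range N, q i) atTop atTop :=
    tendsto_atTop_of_one_div_log_mul h1
  filter_upwards [ae_eventually_norm_sum_pow_le hXm hq0 hq1 hξ_indep hX1 hX01 h1,
    ae_eventually_not_hasRelationAt (fun n hn => (hp n hn).1) hξ_indep hξ_one h3,
    ae_all_iff.2 hX01] with ω hdev hrel h01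
  obtain ⟨hinf, hn⟩ := infinite_and_isUniformlyErgodic_nth (A := randomSet ξ ω)
    (x := fun i => X i ω) (fun n hn => hn.1) (fun i hi => hi.2)
    (fun i hi => (h01 i).resolve_right fun h => hi ⟨Nat.le_add_left 1 i, h⟩) hq0 hq1 hS h2 hdev
  have hmono : StrictMono (randomSeq ξ ω) := Nat.nth_strictMono hinf
  have hrange : Set.range (randomSeq ξ ω) = randomSet ξ ω := Nat.range_nth_of_infinite hinf
  refine ⟨hinf, ?_, IsUniformlyErgodic.isKazhdanSet hn,
    IsUniformlyErgodic.not_isRigiditySequence hn,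
    IsUniformlyErgodic.isSetOfRecurrence hn hmono.tendsto_atTop⟩
  exact isNullpotent_of_eventually_not_hasRelationAt hmono.id_le (by rwa [hrange])
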